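/- **Setting.** Let $A$ be an at most countable set, let $E_0$ and $E_a$ ($a\in A$) be Polish spaces, and let $Z$ be an $E_0$-valued and $X_a$ an $E_a$-valued random variable on a standard Borel probability space $(\Omega,\mathbb P)$, such that the family $X=(X_a)_{a\in A}$ is conditionally independent given $Z$. Functionals are random variables $F=f(Z,X)$ with $f:E_0\times\prod_aE_a\to\mathbb R$ measurable (in particular $F=f(X)$). Put $\mathcal G^a=\sigma(X_b,\,b\ne a)\vee\sigma(Z)$ and $D_aF=F-\mathbb E[F\mid\mathcal G^a]$. - $\mathsf LF=-\sum_{a\in A}D_aF$; the domain $\operatorname{dom}\mathsf L$ is the set of $F\in L^2$ for which this series converges in $L^2$ (along the finite subsets of $A$). - $\mathsf L^{-1}F$ is the functional $G\in L^2$ with $\mathbb E[G\mid Z]=0$ and $\mathsf LG=F$. - $\Gamma(F,G)=\tfrac12\{\mathsf L(FG)-F\,\mathsf LG-G\,\mathsf LF\}$, that is $\Gamma(F,G)=\tfrac12\sum_{a\in A}\bigl(F\,D_aG+G\,D_aF-D_a(FG)\bigr)$; it is said to exist when this series converges in $L^1$ (along the finite subsets of $A$). - $\|DF\|^2=\sum_{a\in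 A}\mathbb E[(D_aF)^2]\in[0,\infty]$. - $\Delta^aF=f(Z,X)-f(Z,X^{(a)})$, where $X^{(a)}$ is $X$ with $X_a$ replaced by $X_a'$; here $X'_a$ has, given $Z$, the conditional law of $X_a$ given $Z$ and is conditionally independent of $X$ given $Z$. - $d_W(F,\mathcal N(0,1))=\sup_h|\mathbb E[h(F)]-\mathbb E[h(Y)]|$ over all $1$-Lipschitz $h:\mathbb R\to\mathbb R$, where $Y\sim\mathcal N(0,1)$. **Theorem.** Let $F\in L^3$ be a functional with $\mathbb E[F\mid Z]=0$ and $\mathbb E[F^2]=1$. Then $\mathsf L^{-1}F$ exists, $\Gamma(F,\mathsf L^{-1}F)$ exists whenever $\|DF\|^2<\infty$, and, whenever $\Gamma(F,\mathsf L^{-1}F)$ exists, $$d_W(F,\mathcal N(0,1))\le\sqrt{\tfrac2\pi}\;\mathbb E\bigl|\Gamma(F,-\mathsf L^{-1}F)-1\bigr|+\frac12\sum_{a\in A}\mathbb E\bigl[|\Delta^a\mathsf L^{-1}F|\,(\Delta^aF)^2\bigr].$$ If moreover $F\in L^4$, and $\Gamma(F,\mathsf L^{-1}F)$ exists, then for $F\in\operatorname{dom}\mathsf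 L$ $$d_W(F,\mathcal N(0,1))\le\sqrt{\tfrac2\pi}\sqrt{\operatorname{var}\Gamma(F,\mathsf L^{-1}F)}+\frac{\sqrt2}{2}\sqrt{-\mathbb E[F\,\mathsf LF]}\sqrt{\sum_{a\in A}\mathbb E\bigl[|\Delta^aF|^4\bigr]},$$ and, also for $F\notin\operatorname{dom}\mathsf L$, the same bound holds with $\|DF\|^2$ in place of $-\mathbb E[F\,\mathsf LF]$. The right-hand sides take values in $[0,\infty]$. -/

import Mathlib

open MeasureTheory ProbabilityTheory Filter Topology
open scoped ENNReal NNReal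

noncomputable section

namespace CondMalliavin

variable {Ω A E₀ : Type*} {E : A → Type*} [MeasurableSpace Ω] [MeasurableSpace E₀]
  [∀ a, MeasurableSpace (E a)]

/-- The random variable `f(Z, X)` attached to a function `f` on `E₀ × ∏ₐ Eₐ`. -/
def functional (Z : Ω → E₀) (X : ∀ a, Ω → E a) (f : E₀ × (∀ a, E a) → ℝ) : Ω → ℝ :=
  fun ω => f (Z ω, fun a => X a ω)

/-- The σ-field `σ(Z)`. -/
abbrev sigmaZ (Z : Ω → E₀) : MeasurableSpace Ω :=
  MeasurableSpace.comap Z inferInstance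

/-- The σ-field `𝒢ᵃ = σ(X_b, b ≠ a) ∨ σ(Z)`. -/
abbrev sigmaWithout (Z : Ω → E₀) (X : ∀ a, Ω → E a) (a : A) : MeasurableSpace Ω :=
  sigmaZ Z ⊔ ⨆ b : {b : A // b ≠ a}, MeasurableSpace.comap (X b.1) inferInstance

/-- The discrete gradient `Dₐ F = F - E[F | 𝒢ᵃ]`. -/
def grad (μ : Measure Ω) (Z : Ω → E₀) (X : ∀ a, Ω → E a) (a : A) (F : Ω → ℝ) : Ω → ℝ :=
  F - μ[F | sigmaWithout Z X a]

/-- `‖D F‖² = ∑ₐ E[(Dₐ F)²]`, in `[0, ∞]`; it is finite exactly on the domain of `D`. -/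
def gradEnergy (μ : Measure Ω) (Z : Ω → E₀) (X : ∀ a, Ω → E a) (F : Ω → ℝ) : ℝ≥0∞ :=
  ∑' a, ∫⁻ ω, ‖grad μ Z X a F ω‖ₑ ^ 2 ∂μ

/-- `F` is in the domain of the Ornstein-Uhlenbeck operator `L` and `H = L F = - ∑ₐ Dₐ F`.
The series converges in `L²`, along the finite subsets of the index set. -/
def IsGenerator (μ : Measure Ω) (Z : Ω → E₀) (X : ∀ a, Ω → E a) (F H : Ω → ℝ) : Prop :=
  MemLp F 2 μ ∧ MemLp H 2 μ ∧
    Tendsto (fun J : Finset A => eLpNorm (fun ω => -(∑ a ∈ J, grad μ Z X a F ω) - H ω) 2 μ)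
      atTop (𝓝 0)

/-- `g(Z, X) = L⁻¹ F`: the square-integrable functional with `E[g(Z, X) | Z] = 0` and
`L (g(Z, X)) = F`. -/
def IsPseudoInverse (μ : Measure Ω) (Z : Ω → E₀) (X : ∀ a, Ω → E a) (F : Ω → ℝ)
    (g : E₀ × (∀ a, E a) → ℝ) : Prop :=
  Measurable g ∧ μ[functional Z X g | sigmaZ Z] =ᵐ[μ] 0 ∧
    IsGenerator μ Z X (functional Z X g) F

/-- `γ = Γ(F, G) = ½ (L (F G) - F L G - G L F)` for `L = - ∑ₐ Dₐ`, where the series of the combined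
terms `½ (F Dₐ G + G Dₐ F - Dₐ (F G))` converges in `L¹`, along the finite subsets of the index
set. -/
def IsCarreDuChamp (μ : Measure Ω) (Z : Ω → E₀) (X : ∀ a, Ω → E a) (F G γ : Ω → ℝ) : Prop :=
  Integrable γ μ ∧
    Tendsto (fun J : Finset A => eLpNorm (fun ω =>
      ∑ a ∈ J, (1 / 2 : ℝ) * (F ω * grad μ Z X a G ω + G ω * grad μ Z X a F ω
        - grad μ Z X a (F * G) ω) - γ ω) 1 μ)
      atTop (𝓝 0)

open Classical in
/-- The difference operator `Δᵃ f (z, x; y) = f(z, x) - f(z, x with the a-th coordinate replaced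
by y)`. -/
def diffOp (f : E₀ × (∀ a, E a) → ℝ) (a : A) (p : E₀ × (∀ a, E a)) (y : E a) : ℝ :=
  f p - f (p.1, Function.update p.2 a y)

/-- `E[φ((Z, X), X'ₐ)]`, where `X'ₐ` is a copy of `Xₐ`: given `Z` it has the conditional law
of `Xₐ` given `Z` and it is independent of `X`. -/
def expectCopy (μ : Measure Ω) [IsFiniteMeasure μ] (Z : Ω → E₀) (X : ∀ a, Ω → E a) (a : A)
    [StandardBorelSpace (E a)] [Nonempty (E a)]
    (φ : E₀ × (∀ a, E a) → E a → ℝ≥0∞) : ℝ≥0∞ :=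
  ∫⁻ ω, ∫⁻ y, φ (Z ω, fun b => X b ω) y ∂(condDistrib (X a) Z μ (Z ω)) ∂μ

/-- The 1-Wasserstein distance between two laws on `ℝ` (with finite first moments), as the supremum
over 1-Lipschitz test functions. -/
def wassersteinDist (ν₁ ν₂ : Measure ℝ) : ℝ≥0∞ :=
  ⨆ (h : ℝ → ℝ) (_ : LipschitzWith 1 h), ENNReal.ofReal |(∫ x, h x ∂ν₁) - ∫ x, h x ∂ν₂|

end CondMalliavin

end

/-!
The proof rests on exchangeability. For fixed `a`, let `X'ₐ` be the conditional copy of `Xₐ`. The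
law of `((Z, X), X'ₐ)` (`copyLaw`) is invariant under exchanging `Xₐ` and `X'ₐ`
(`map_swapCopy_copyLaw`), and `E[· | 𝒢ᵃ]` is integration over the copy
(`condExp_sigmaWithout_eq_avgCopy`). Hence `E[U Dₐ G] = ½ E[ΔᵃU ΔᵃG]` (`integral_grad_mul`), and the
`a`-th term of `Γ(F, G)`, tested against a bounded function of `(Z, X)`, is
`½ E[ΔᵃF ΔᵃG u(Z, X)]` (`integral_carreTerm_mul`).

*The operator `L`.* On `L²` the projections `P_S = E[· | Z, X_b, b ∈ S]` satisfy
`P_S P_T = P_{S ∩ T}`, by conditional independence. For a centred `F` the Möbius transforms of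
`S ↦ P_S F` over finite sets `I` give an orthogonal expansion `F = ∑_I F_I` over nonempty `I`
(`hasSum_chaos`), and `Dₐ` keeps exactly the `F_I` with `a ∈ I`. So `L F_I = -|I| F_I`, and
`L⁻¹F = -∑_I |I|⁻¹ F_I` (`exists_isPseudoInverse`). The telescoping of the projections along an
enumeration of a finite set gives the Efron–Stein inequality `E[F²] ≤ ‖DF‖²`
(`ofReal_integral_sq_le_gradEnergy`). With `G = L⁻¹F`, the identity `‖DG‖² = -E[G F]` and the
Efron–Stein inequality for `G` yield `‖DG‖² ≤ E[F²] = 1` (`gradEnergy_le_one`); two finite energies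
make the series for `Γ(F, G)` absolutely convergent in `L¹` (`exists_isCarreDuChamp`).

*Stein's method.* For `h` differentiable and 1-Lipschitz, the equation
`φ'(x) - x φ(x) = h(x) - E[h(Y)]` has a bounded solution with `|φ'| ≤ √(2/π)` and `φ'` 2-Lipschitz
(`exists_stein_solution`). Integration by parts gives
`E[F φ(F)] = -∑ₐ E[φ(F) Dₐ L⁻¹F] = -½ ∑ₐ E[Δᵃ(φ(F)) Δᵃ L⁻¹F]`. Replacing `Δᵃ(φ(F))` by
`φ'(F) ΔᵃF` turns the sum into `E[φ'(F) Γ(F, -L⁻¹F)]`, and costs at most `(ΔᵃF)²` in each term. This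
is the first bound (`wassersteinDist_gaussianReal_le`). The second one follows by Cauchy–Schwarz
from `E[Γ(F, -L⁻¹F)] = 1`, `E[(Δᵃ L⁻¹F)²] = 2 E[(Dₐ L⁻¹F)²]` and `‖D L⁻¹F‖² ≤ 1 ≤ ‖DF‖²`
(`wassersteinDist_gaussianReal_le_evariance_add`).
-/

noncomputable section

set_option linter.unusedSectionVars false

namespace CondMalliavin

/-! ### Stein's equation for the normal law -/

lemma integral_abs_gaussianReal : ∫ y, |y| ∂(gaussianReal 0 1) = √(2 / Real.pi) := by
  rw [integral_gaussianReal_eq_integral_smul one_ne_zero]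
  have h1 : ∀ y : ℝ, gaussianPDFReal 0 1 y • |y|
      = (fun r : ℝ => (√(2 * Real.pi))⁻¹ * (r * Real.exp (-r ^ 2 / 2))) |y| := by
    intro y
    simp [gaussianPDFReal, sq_abs]
    ring
  rw [integral_congr_ae (ae_of_all _ h1)]
  refine (integral_comp_abs
    (f := fun r : ℝ => (√(2 * Real.pi))⁻¹ * (r * Real.exp (-r ^ 2 / 2)))).trans ?_
  rw [integral_const_mul]
  have h2 : ∫ r in Set.Ioi (0 : ℝ), r * Real.exp (-r ^ 2 / 2) = 1 := by
    have hd : ∀ x ∈ Set.Ici (0 : ℝ),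
        HasDerivAt (fun r : ℝ => -Real.exp (-r ^ 2 / 2)) (x * Real.exp (-x ^ 2 / 2)) x := by
      intro x _
      have h := ((((hasDerivAt_id x).pow 2).neg.div_const 2).exp).neg
      convert! h using 1
      simp
      ring
    have ht : Tendsto (fun r : ℝ => -Real.exp (-r ^ 2 / 2)) atTop (𝓝 0) := by
      have : Tendsto (fun r : ℝ => -r ^ 2 / 2) atTop atBot := by
        have := (tendsto_pow_atTop (α := ℝ) two_ne_zero).atTop_div_const (two_pos)
        have := tendsto_neg_atTop_atBot.comp this
        refine this.congr fun x => ?_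
        simp
        ring
      simpa using (Real.tendsto_exp_atBot.comp this).neg
    have := integral_Ioi_of_hasDerivAt_of_nonneg' hd (fun x hx => by
      have : (0 : ℝ) < x := hx
      positivity) ht
    simpa using this
  rw [h2, mul_one]
  rw [eq_comm, Real.sqrt_eq_iff_mul_self_eq (by positivity) (by positivity)]
  have h3 : √(2 * Real.pi) * √(2 * Real.pi) = 2 * Real.pi := Real.mul_self_sqrt (by positivity)
  field_simp
  rw [sq, h3]

lemma integrable_of_linear_growth_gaussianReal {g : ℝ → ℝ} (hg : Continuous g) {K C : ℝ}
    (hgb : ∀ y, |g y| ≤ K + C * |y|) : Integrable g (gaussianReal 0 1) := by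
  have hid : Integrable (fun y : ℝ => |y|) (gaussianReal 0 1) :=
    ((memLp_id_gaussianReal (μ := 0) (v := 1) 1).integrable le_rfl).abs
  refine ((integrable_const K).add (hid.const_mul C)).mono' hg.aestronglyMeasurable
    (ae_of_all _ fun y => ?_)
  simpa using hgb y

/-- Gaussian integration by parts. -/
lemma integral_deriv_gaussianReal {g g' : ℝ → ℝ} (hg : ∀ y, HasDerivAt g (g' y) y)
    (hg' : Continuous g') {C : ℝ} (hC : ∀ y, |g' y| ≤ C) :
    ∫ y, y * g y ∂(gaussianReal 0 1) = ∫ y, g' y ∂(gaussianReal 0 1) := by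
  have hgc : Continuous g := continuous_iff_continuousAt.2 fun y => (hg y).continuousAt
  have hlin : ∀ y, |g y| ≤ |g 0| + C * |y| := by
    intro y
    have h := Convex.norm_image_sub_le_of_norm_hasDerivWithin_le (s := Set.univ)
      (fun x _ => (hg x).hasDerivWithinAt) (fun x _ => hC x) convex_univ
      (Set.mem_univ (0 : ℝ)) (Set.mem_univ y)
    simp only [Real.norm_eq_abs, sub_zero] at h
    have := abs_sub_abs_le_abs_sub (g y) (g 0)
    linarith
  have hC0 : 0 ≤ C := (abs_nonneg _).trans (hC 0)
  have hsq : Integrable (fun y : ℝ => y ^ 2) (gaussianReal 0 1) :=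
    (memLp_id_gaussianReal (μ := 0) (v := 1) 2).integrable_sq
  have hid : Integrable (fun y : ℝ => |y|) (gaussianReal 0 1) :=
    ((memLp_id_gaussianReal (μ := 0) (v := 1) 1).integrable le_rfl).abs
  have i1 : Integrable (fun y => y * g y) (gaussianReal 0 1) := by
    refine ((hid.mul_const |g 0|).add (hsq.const_mul C)).mono'
      (by fun_prop) (ae_of_all _ fun y => ?_)
    simp only [Real.norm_eq_abs, abs_mul, Pi.add_apply]
    have := mul_le_mul_of_nonneg_left (hlin y) (abs_nonneg y)
    nlinarith [sq_abs y]
  have i2 : Integrable g (gaussianReal 0 1) := integrable_of_linear_growth_gaussianReal hgc hlin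
  have i3 : Integrable g' (gaussianReal 0 1) :=
    integrable_of_linear_growth_gaussianReal hg' (K := C) (C := 0) (by simpa using hC)
  have key : ∀ {k : ℝ → ℝ}, Integrable k (gaussianReal 0 1) →
      Integrable (fun y => gaussianPDFReal 0 1 y * k y) volume := by
    intro k hk
    rw [gaussianReal_of_var_ne_zero _ one_ne_zero, integrable_withDensity_iff_integrable_smul'
      (measurable_gaussianPDF _ _) (ae_of_all _ fun _ => gaussianPDF_lt_top)] at hk
    simpa [gaussianPDF, ENNReal.toReal_ofReal (gaussianPDFReal_nonneg _ _ _)] using hk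
  have hd : ∀ y, HasDerivAt (gaussianPDFReal 0 1) (-(y * gaussianPDFReal 0 1 y)) y := by
    intro y
    have h := ((((hasDerivAt_id y).pow 2).neg.div_const 2).exp).const_mul ((√(2 * Real.pi))⁻¹)
    convert! h using 1
    · ext z
      simp [gaussianPDFReal]
    · simp [gaussianPDFReal]
      ring
  have := integral_mul_deriv_eq_deriv_mul_of_integrable (u := g) (v := gaussianPDFReal 0 1)
    (fun y _ => hg y) (fun y _ => hd y) ?_ ?_ ?_
  · rw [integral_gaussianReal_eq_integral_smul one_ne_zero,
      integral_gaussianReal_eq_integral_smul one_ne_zero]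
    simp only [smul_eq_mul]
    have e1 : ∀ y, gaussianPDFReal 0 1 y * (y * g y) = -(g y * -(y * gaussianPDFReal 0 1 y)) :=
      fun y => by ring
    simp_rw [e1, integral_neg, this, neg_neg, mul_comm]
  · refine (key i1).neg.congr (ae_of_all _ fun y => ?_)
    simp only [Pi.mul_apply, Pi.neg_apply]
    ring
  · refine (key i3).congr (ae_of_all _ fun y => ?_)
    simp only [Pi.mul_apply]
    ring
  · refine (key i2).congr (ae_of_all _ fun y => ?_)
    simp only [Pi.mul_apply]
    ring

/-- The solution of Stein's equation given by interpolating along circular arcs,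
`φ x = - ∫_0^{π/2} E[N h(x cos θ + N sin θ)] dθ` with `N` standard normal. In this form the bound
`|φ'| ≤ E|N|` is immediate; Stein's equation itself follows from Gaussian integration by parts and
the fundamental theorem of calculus in `θ`. -/
lemma exists_stein_solution_of_deriv {h h' : ℝ → ℝ} (hh : ∀ x, HasDerivAt h (h' x) x)
    (hc : Continuous h') (hb : ∀ x, |h' x| ≤ 1) :
    ∃ φ : ℝ → ℝ, (∃ C, ∀ x, |φ x| ≤ C) ∧
      (∀ x, HasDerivAt φ (x * φ x + (h x - ∫ y, h y ∂(gaussianReal 0 1))) x) ∧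
      ∀ x, |x * φ x + (h x - ∫ y, h y ∂(gaussianReal 0 1))| ≤ √(2 / Real.pi) := by
  set γ := gaussianReal 0 1 with hγ
  set τ : Measure ℝ := volume.restrict (Set.Ioc 0 (Real.pi / 2)) with hτ
  set ν : Measure (ℝ × ℝ) := τ.prod γ with hν
  have hpi : 0 ≤ Real.pi / 2 := by positivity
  have hcont : Continuous h := continuous_iff_continuousAt.2 fun y => (hh y).continuousAt
  have hlip : ∀ x y, |h y - h x| ≤ |y - x| := by
    intro x y
    have := Convex.norm_image_sub_le_of_norm_hasDerivWithin_le (s := Set.univ)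
      (fun x _ => (hh x).hasDerivWithinAt) (fun x _ => hb x) convex_univ
      (Set.mem_univ x) (Set.mem_univ y)
    simpa using this
  have hlin : ∀ y, |h y| ≤ |h 0| + 1 * |y| := by
    intro y
    have := abs_sub_abs_le_abs_sub (h y) (h 0)
    have := hlip 0 y
    rw [sub_zero] at this
    linarith
  have hid : Integrable (fun y : ℝ => |y|) γ :=
    ((memLp_id_gaussianReal (μ := 0) (v := 1) 1).integrable le_rfl).abs
  have hsq : Integrable (fun y : ℝ => y ^ 2) γ :=
    (memLp_id_gaussianReal (μ := 0) (v := 1) 2).integrable_sq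
  have hidν : Integrable (fun q : ℝ × ℝ => |q.2|) ν := hid.comp_snd τ
  have hsqν : Integrable (fun q : ℝ × ℝ => q.2 ^ 2) ν := hsq.comp_snd τ
  let arc : ℝ → ℝ × ℝ → ℝ := fun x q => x * Real.cos q.1 + q.2 * Real.sin q.1
  have harc : ∀ x, Continuous (arc x) := fun x => by fun_prop
  let φ : ℝ → ℝ := fun x => -∫ q, q.2 * h (arc x q) ∂ν
  have hint : ∀ x, Integrable (fun q : ℝ × ℝ => q.2 * h (arc x q)) ν := by
    intro x
    refine ((hidν.mul_const (|h 0| + |x|)).add hsqν).mono'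
      (by fun_prop) (ae_of_all _ fun q => ?_)
    simp only [Real.norm_eq_abs, abs_mul, Pi.add_apply]
    have h1 : |arc x q| ≤ |x| + |q.2| := by
      refine (abs_add_le _ _).trans ?_
      rw [abs_mul, abs_mul]
      exact add_le_add (mul_le_of_le_one_right (abs_nonneg _) (Real.abs_cos_le_one _))
        (mul_le_of_le_one_right (abs_nonneg _) (Real.abs_sin_le_one _))
    have h2 := hlin (arc x q)
    have h3 : |h (arc x q)| ≤ |h 0| + |x| + |q.2| := by linarith
    have := mul_le_mul_of_nonneg_left h3 (abs_nonneg q.2)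
    nlinarith [sq_abs q.2]
  have hint' : ∀ x, Integrable (fun q : ℝ × ℝ => q.2 * (h' (arc x q) * Real.cos q.1)) ν := by
    intro x
    refine hidν.mono' (by fun_prop) (ae_of_all _ fun q => ?_)
    simp only [Real.norm_eq_abs, abs_mul]
    exact mul_le_of_le_one_right (abs_nonneg _)
      (mul_le_one₀ (hb _) (abs_nonneg _) (Real.abs_cos_le_one _))
  have hints : ∀ x, Integrable (fun q : ℝ × ℝ => h' (arc x q) * Real.sin q.1) ν := by
    intro x
    refine (integrable_const (1 : ℝ)).mono' (by fun_prop) (ae_of_all _ fun q => ?_)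
    simp only [Real.norm_eq_abs, abs_mul]
    exact mul_le_one₀ (hb _) (abs_nonneg _) (Real.abs_sin_le_one _)
  have hderiv : ∀ x, HasDerivAt φ (-∫ q, q.2 * (h' (arc x q) * Real.cos q.1) ∂ν) x := by
    intro x
    refine HasDerivAt.neg ?_
    refine (hasDerivAt_integral_of_dominated_loc_of_deriv_le (bound := fun q => |q.2|)
      (F := fun x q => q.2 * h (arc x q))
      (F' := fun x q => q.2 * (h' (arc x q) * Real.cos q.1)) (s := Set.univ)
      univ_mem (Eventually.of_forall fun x => (hint x).aestronglyMeasurable)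
      (hint x) (hint' x).aestronglyMeasurable (ae_of_all _ fun q y _ => ?_) hidν
      (ae_of_all _ fun q y _ => ?_)).2
    · simp only [Real.norm_eq_abs, abs_mul]
      exact mul_le_of_le_one_right (abs_nonneg _)
        (mul_le_one₀ (hb _) (abs_nonneg _) (Real.abs_cos_le_one _))
    · have h1 : HasDerivAt (fun y => arc y q) (Real.cos q.1) y := by
        simpa [arc] using (hasDerivAt_id y).mul_const (Real.cos q.1)
      exact ((hh _).comp y h1).const_mul q.2
  -- Gaussian integration by parts removes the factor `N` from `φ`.
  have hparts : ∀ x, φ x = -∫ q, h' (arc x q) * Real.sin q.1 ∂ν := by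
    intro x
    simp only [φ]
    rw [hν, integral_prod _ (hint x), integral_prod _ (hints x)]
    congr 1
    refine integral_congr_ae (ae_of_all _ fun θ => ?_)
    refine integral_deriv_gaussianReal (g := fun y => h (arc x (θ, y))) (C := 1)
      (fun y => ?_) (by fun_prop) (fun y => ?_)
    · have h1 : HasDerivAt (fun y => arc x (θ, y)) (Real.sin θ) y := by
        simpa [arc] using (hasDerivAt_id y).mul_const (Real.sin θ)
      exact (hh _).comp y h1
    · rw [abs_mul]
      exact mul_le_one₀ (hb _) (abs_nonneg _) (Real.abs_sin_le_one _)
  -- The arc leads from `x` at `θ = 0` to `N` at `θ = π / 2`.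
  have hftc : ∀ x, (∫ y, h y ∂γ) - h x
      = ∫ q, h' (arc x q) * (q.2 * Real.cos q.1 - x * Real.sin q.1) ∂ν := by
    intro x
    have hI : Integrable
        (fun q : ℝ × ℝ => h' (arc x q) * (q.2 * Real.cos q.1 - x * Real.sin q.1)) ν := by
      refine ((hint' x).sub ((hints x).const_mul x)).congr (ae_of_all _ fun q => ?_)
      simp only [Pi.sub_apply]
      ring
    rw [hν, integral_prod_symm _ hI]
    have h1 : ∀ y, ∫ θ, h' (arc x (θ, y)) * (y * Real.cos θ - x * Real.sin θ) ∂τ = h y - h x := by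
      intro y
      rw [hτ, ← intervalIntegral.integral_of_le hpi,
        intervalIntegral.integral_eq_sub_of_hasDerivAt (f := fun θ => h (arc x (θ, y)))
          (fun θ _ => ?_) (Continuous.intervalIntegrable (by fun_prop) _ _)]
      · simp [arc]
      · have h1 : HasDerivAt (fun θ => arc x (θ, y)) (y * Real.cos θ - x * Real.sin θ) θ := by
          have := ((Real.hasDerivAt_cos θ).const_mul x).add ((Real.hasDerivAt_sin θ).const_mul y)
          convert! this using 1
          ring
        exact (hh _).comp θ h1
    simp only [h1]
    rw [integral_sub (integrable_of_linear_growth_gaussianReal hcont hlin) (integrable_const _)]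
    simp [hγ]
  have hode : ∀ x, -∫ q, q.2 * (h' (arc x q) * Real.cos q.1) ∂ν
      = x * φ x + (h x - ∫ y, h y ∂γ) := by
    intro x
    have h1 : h x - ∫ y, h y ∂γ
        = -∫ q, h' (arc x q) * (q.2 * Real.cos q.1 - x * Real.sin q.1) ∂ν := by
      rw [← hftc]
      ring
    rw [h1, hparts, mul_neg, ← integral_const_mul, ← neg_add,
      ← integral_add ((hints x).const_mul x) ?_]
    · congr 2
      ext q
      ring
    · refine ((hint' x).sub ((hints x).const_mul x)).congr (ae_of_all _ fun q => ?_)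
      simp only [Pi.sub_apply]
      ring
  -- The form without the factor `N` bounds `φ`, the one with it bounds `φ'`, as `∫ cos = 1`.
  refine ⟨φ, ⟨1 * ν.real Set.univ, fun x => ?_⟩, fun x => hode x ▸ hderiv x, fun x => ?_⟩
  · rw [hparts, abs_neg]
    refine norm_integral_le_of_norm_le_const (μ := ν)
      (f := fun q => h' (arc x q) * Real.sin q.1) (ae_of_all _ fun q => ?_)
    rw [Real.norm_eq_abs, abs_mul]
    exact mul_le_one₀ (hb _) (abs_nonneg _) (Real.abs_sin_le_one _)
  · rw [← hode, abs_neg]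
    have hcos : Integrable Real.cos τ := Real.continuous_cos.integrableOn_Ioc
    have hle : ∀ᵐ q ∂ν, ‖q.2 * (h' (arc x q) * Real.cos q.1)‖ ≤ Real.cos q.1 * |q.2| := by
      have : ∀ᵐ q ∂ν, q.1 ∈ Set.Ioc 0 (Real.pi / 2) :=
        Measure.quasiMeasurePreserving_fst.ae (ae_restrict_mem measurableSet_Ioc)
      filter_upwards [this] with q hq
      rw [Real.norm_eq_abs, abs_mul, abs_mul, mul_comm]
      have h0 : 0 ≤ Real.cos q.1 := Real.cos_nonneg_of_mem_Icc ⟨by linarith [hq.1], hq.2⟩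
      rw [abs_of_nonneg h0]
      exact mul_le_mul_of_nonneg_right (mul_le_of_le_one_left h0 (hb _)) (abs_nonneg _)
    have hI : Integrable (fun q : ℝ × ℝ => Real.cos q.1 * |q.2|) ν := hcos.mul_prod hid
    refine (norm_integral_le_of_norm_le hI hle).trans (le_of_eq ?_)
    rw [hν, integral_prod_mul Real.cos (fun y : ℝ => |y|), hγ, integral_abs_gaussianReal, hτ,
      ← intervalIntegral.integral_of_le hpi]
    simp

/-- For a nondecreasing right-hand side the bounded solution `φ` of Stein's equation makes
`x ↦ x φ(x)` nonincreasing. At a point `x₀` the solution is compared with `- κ x / (1 + x²)`,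
`κ = h x₀ - c`: the difference, multiplied by the integrating factor `exp (- x² / 2)`, is monotone
on the half-line starting at `x₀` on which `h - c - κ` has the sign of `κ`, and it vanishes
at infinity. -/
lemma antitone_mul_of_stein_equation {h φ : ℝ → ℝ} {c C : ℝ} (hmono : Monotone h)
    (hC : ∀ x, |φ x| ≤ C) (hφ : ∀ x, HasDerivAt φ (x * φ x + (h x - c)) x) :
    Antitone fun x => x * φ x := by
  have hd : ∀ x, HasDerivAt (fun x => x * φ x) (1 * φ x + x * (x * φ x + (h x - c))) x :=
    fun x => (hasDerivAt_id x).mul (hφ x)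
  refine antitone_of_deriv_nonpos (fun x => (hd x).differentiableAt) fun x₀ => ?_
  rw [(hd x₀).deriv]
  set κ := h x₀ - c with hκ
  let D : ℝ → ℝ := fun x => (φ x + κ * (x / (1 + x ^ 2))) * Real.exp (-x ^ 2 / 2)
  have hD : ∀ x, HasDerivAt D
      (Real.exp (-x ^ 2 / 2) * (h x - h x₀ + 2 * κ / (1 + x ^ 2) ^ 2)) x := by
    intro x
    have hpos : (1 + x ^ 2) ≠ 0 := by positivity
    have h1 : HasDerivAt (fun x : ℝ => x / (1 + x ^ 2))
        ((1 * (1 + x ^ 2) - x * (2 * x)) / (1 + x ^ 2) ^ 2) x := by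
      refine (hasDerivAt_id x).div ?_ hpos
      simpa using ((hasDerivAt_id x).pow 2).const_add 1
    have h2 : HasDerivAt (fun x : ℝ => Real.exp (-x ^ 2 / 2)) (Real.exp (-x ^ 2 / 2) * (-x)) x := by
      have h := (((hasDerivAt_id x).pow 2).neg.div_const 2).exp
      convert! h using 1
      simp
      ring
    refine ((hφ x).fun_add (h1.const_mul κ)).fun_mul h2 |>.congr_deriv ?_
    rw [hκ]
    field_simp
    ring
  have hbd : ∀ x, |φ x + κ * (x / (1 + x ^ 2))| ≤ C + |κ| := by
    intro x
    refine (abs_add_le _ _).trans (add_le_add (hC x) ?_)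
    rw [abs_mul, abs_div, abs_of_pos (by positivity : 0 < 1 + x ^ 2)]
    refine mul_le_of_le_one_right (abs_nonneg _) ?_
    rw [div_le_one (by positivity)]
    nlinarith [sq_abs x, sq_nonneg (|x| - 1)]
  have hlim : ∀ l : Filter ℝ, Tendsto (fun x : ℝ => x ^ 2) l atTop → Tendsto D l (𝓝 0) := by
    intro l hl
    have he : Tendsto (fun x : ℝ => Real.exp (-x ^ 2 / 2)) l (𝓝 0) := by
      refine Real.tendsto_exp_atBot.comp ?_
      refine (tendsto_neg_atTop_atBot.comp (hl.atTop_div_const two_pos)).congr fun x => ?_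
      simp
      ring
    refine squeeze_zero_norm (a := fun x => (C + |κ|) * Real.exp (-x ^ 2 / 2)) (fun x => ?_)
      (by simpa using he.const_mul (C + |κ|))
    rw [norm_mul, Real.norm_eq_abs, Real.norm_eq_abs, Real.abs_exp]
    exact mul_le_mul_of_nonneg_right (hbd x) (Real.exp_pos _).le
  have hDx : D x₀ ≤ 0 := by
    have hcontD : Continuous D := continuous_iff_continuousAt.2 fun x => (hD x).continuousAt
    rcases le_total 0 κ with hk | hk
    · have hm : MonotoneOn D (Set.Ici x₀) := by
        refine monotoneOn_of_deriv_nonneg (convex_Ici x₀) hcontD.continuousOn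
          (fun x _ => (hD x).differentiableAt.differentiableWithinAt) fun x hx => ?_
        rw [interior_Ici] at hx
        rw [(hD x).deriv]
        have := hmono (le_of_lt hx)
        have : 0 ≤ 2 * κ / (1 + x ^ 2) ^ 2 := by positivity
        exact mul_nonneg (Real.exp_pos _).le (by linarith)
      refine ge_of_tendsto (hlim atTop (tendsto_pow_atTop two_ne_zero)) ?_
      filter_upwards [eventually_ge_atTop x₀] with x hx
      exact hm Set.self_mem_Ici hx hx
    · have hm : AntitoneOn D (Set.Iic x₀) := by
        refine antitoneOn_of_deriv_nonpos (convex_Iic x₀) hcontD.continuousOn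
          (fun x _ => (hD x).differentiableAt.differentiableWithinAt) fun x hx => ?_
        rw [interior_Iic] at hx
        rw [(hD x).deriv]
        have := hmono (le_of_lt hx)
        have : 2 * κ / (1 + x ^ 2) ^ 2 ≤ 0 :=
          div_nonpos_of_nonpos_of_nonneg (by linarith) (by positivity)
        exact mul_nonpos_of_nonneg_of_nonpos (Real.exp_pos _).le (by linarith)
      refine ge_of_tendsto (hlim atBot ?_) ?_
      · refine ((tendsto_pow_atTop (α := ℝ) two_ne_zero).comp tendsto_abs_atBot_atTop).congr
          fun x => ?_
        simp
      filter_upwards [eventually_le_atBot x₀] with x hx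
      exact hm hx Set.self_mem_Iic hx
  have h1 : φ x₀ + κ * (x₀ / (1 + x₀ ^ 2)) ≤ 0 := by
    by_contra! hlt
    exact absurd (mul_pos hlt (Real.exp_pos (-x₀ ^ 2 / 2))) (not_lt.2 hDx)
  have h2 : (φ x₀ + κ * (x₀ / (1 + x₀ ^ 2))) * (1 + x₀ ^ 2) ≤ 0 :=
    mul_nonpos_of_nonpos_of_nonneg h1 (by positivity)
  have h3 : (φ x₀ + κ * (x₀ / (1 + x₀ ^ 2))) * (1 + x₀ ^ 2) = φ x₀ * (1 + x₀ ^ 2) + κ * x₀ := by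
    field_simp
  nlinarith

/-- Stein's equation `φ' x - x φ x = h x - E[h(N)]` for a continuously differentiable `1`-Lipschitz
function `h`, with the sharp bounds `|φ'| ≤ √(2/π)` and `|φ''| ≤ 2` (the latter as a Lipschitz
bound). -/
theorem exists_stein_solution {h h' : ℝ → ℝ} (hh : ∀ x, HasDerivAt h (h' x) x)
    (hc : Continuous h') (hb : ∀ x, |h' x| ≤ 1) :
    ∃ φ φ' : ℝ → ℝ, (∃ C, ∀ x, |φ x| ≤ C) ∧ (∀ x, HasDerivAt φ (φ' x) x) ∧
      (∀ x, φ' x - x * φ x = h x - ∫ y, h y ∂(gaussianReal 0 1)) ∧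
      (∀ x, |φ' x| ≤ √(2 / Real.pi)) ∧ LipschitzWith 2 φ' := by
  obtain ⟨φ, ⟨C, hC⟩, hφ, hφ'⟩ := exists_stein_solution_of_deriv hh hc hb
  set c := ∫ y, h y ∂(gaussianReal 0 1)
  refine ⟨φ, fun x => x * φ x + (h x - c), ⟨C, hC⟩, hφ, fun x => by ring, hφ', ?_⟩
  have hlip : ∀ x y, x ≤ y → |h y - h x| ≤ y - x := by
    intro x y hxy
    have := Convex.norm_image_sub_le_of_norm_hasDerivWithin_le (s := Set.univ)
      (fun x _ => (hh x).hasDerivWithinAt) (fun x _ => hb x) convex_univ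
      (Set.mem_univ x) (Set.mem_univ y)
    simpa [abs_of_nonneg (sub_nonneg.2 hxy)] using this
  -- `φ - 1` and `-φ - 1` are the bounded solutions for `x + h` and `x - h`, both nondecreasing.
  have h1 : Antitone fun x => x * (φ x - 1) := by
    refine antitone_mul_of_stein_equation (h := fun x => x + h x) (c := c) (C := C + 1)
      (fun x y hxy => ?_) (fun x => ?_) fun x => ?_
    · have := abs_le.1 (hlip x y hxy)
      simp only
      linarith
    · have := abs_le.1 (hC x)
      exact abs_le.2 ⟨by linarith, by linarith⟩
    · convert! (hφ x).sub_const 1 using 1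
      ring
  have h2 : Antitone fun x => x * (-φ x - 1) := by
    refine antitone_mul_of_stein_equation (h := fun x => x - h x) (c := -c) (C := C + 1)
      (fun x y hxy => ?_) (fun x => ?_) fun x => ?_
    · have := abs_le.1 (hlip x y hxy)
      simp only
      linarith
    · have := abs_le.1 (hC x)
      exact abs_le.2 ⟨by linarith, by linarith⟩
    · convert! (hφ x).neg.sub_const 1 using 1
      ring
  have key : ∀ x y, x ≤ y →
      |(y * φ y + (h y - c)) - (x * φ x + (h x - c))| ≤ 2 * (y - x) := by
    intro x y hxy
    have e1 := h1 hxy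
    have e2 := h2 hxy
    have e3 := abs_le.1 (hlip x y hxy)
    simp only at e1 e2
    exact abs_le.2 ⟨by linarith, by linarith⟩
  refine LipschitzWith.of_dist_le_mul fun x y => ?_
  simp only [Real.dist_eq, NNReal.coe_ofNat]
  rcases le_total x y with hxy | hxy
  · rw [abs_sub_comm, abs_sub_comm x y, abs_of_nonneg (sub_nonneg.2 hxy)]
    exact key x y hxy
  · rw [abs_of_nonneg (sub_nonneg.2 hxy)]
    exact key y x hxy

/-- The Taylor remainder of a function whose derivative is `2`-Lipschitz. -/
lemma abs_taylor_remainder_le {φ φ' : ℝ → ℝ} (hφ : ∀ x, HasDerivAt φ (φ' x) x)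
    (hL : LipschitzWith 2 φ') (x y : ℝ) : |φ x - φ y - φ' x * (x - y)| ≤ (x - y) ^ 2 := by
  have hF : ∀ t : ℝ, HasDerivAt (fun t => φ (x + t * (y - x)) - t * (φ' x * (y - x)))
      (φ' (x + t * (y - x)) * (y - x) - φ' x * (y - x)) t := by
    intro t
    have h1 : HasDerivAt (fun t : ℝ => x + t * (y - x)) (y - x) t := by
      simpa using ((hasDerivAt_id t).mul_const (y - x)).const_add x
    have h2 := ((hφ _).comp t h1).fun_sub ((hasDerivAt_id t).mul_const (φ' x * (y - x)))
    simpa using h2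
  have hB : ∀ t : ℝ, HasDerivAt (fun t : ℝ => t ^ 2 * (x - y) ^ 2) (2 * t * (x - y) ^ 2) t := by
    intro t
    simpa using ((hasDerivAt_id t).pow 2).mul_const ((x - y) ^ 2)
  have := image_norm_le_of_norm_deriv_right_le_deriv_boundary (a := 0) (b := 1)
    (f := fun t => φ (x + t * (y - x)) - t * (φ' x * (y - x)) - φ x)
    (B := fun t : ℝ => t ^ 2 * (x - y) ^ 2)
    (fun t _ => ((hF t).sub_const _).continuousAt.continuousWithinAt)
    (fun t _ => ((hF t).sub_const _).hasDerivWithinAt) (by simp) hB ?_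
    (Set.right_mem_Icc.2 zero_le_one)
  · simp only [one_mul, one_pow, add_sub_cancel, Real.norm_eq_abs] at this
    rw [← abs_neg]
    convert! this using 2
    ring
  · intro t ht
    have h1 := hL.dist_le_mul (x + t * (y - x)) x
    rw [Real.dist_eq, Real.dist_eq] at h1
    simp only [NNReal.coe_ofNat, add_sub_cancel_left] at h1
    rw [← sub_mul, norm_mul, Real.norm_eq_abs, Real.norm_eq_abs]
    refine (mul_le_mul_of_nonneg_right h1 (abs_nonneg _)).trans ?_
    rw [abs_mul, abs_of_nonneg ht.1]
    have : |y - x| * |y - x| = (x - y) ^ 2 := by rw [← sq, sq_abs]; ring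
    rw [← this]
    exact le_of_eq (by ring)

/-- Continuously differentiable `1`-Lipschitz test functions suffice for the Wasserstein distance:
a `1`-Lipschitz `h` is within `ε` of its average over intervals of length `ε`. -/
lemma wassersteinDist_le_of_forall_hasDerivAt {ν₁ ν₂ : Measure ℝ} [IsProbabilityMeasure ν₁]
    [IsProbabilityMeasure ν₂] (h₁ : Integrable id ν₁) (h₂ : Integrable id ν₂) {B : ℝ≥0∞}
    (H : ∀ h h' : ℝ → ℝ, (∀ x, HasDerivAt h (h' x) x) → Continuous h' → (∀ x, |h' x| ≤ 1) →
      ENNReal.ofReal |(∫ x, h x ∂ν₁) - ∫ x, h x ∂ν₂| ≤ B) :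
    wassersteinDist ν₁ ν₂ ≤ B := by
  refine iSup₂_le fun h hL => ENNReal.le_of_forall_pos_le_add fun δ hδ _ => ?_
  set ε : ℝ := δ / 2 with hε
  have hε0 : 0 < ε := by positivity
  have hcont := hL.continuous
  have hlip : ∀ x y, |h x - h y| ≤ |x - y| := fun x y => by
    simpa [Real.dist_eq] using hL.dist_le_mul x y
  let K : ℝ → ℝ := fun x => ∫ t in (0 : ℝ)..x, h t
  have hK : ∀ x, HasDerivAt K (h x) x := fun x =>
    intervalIntegral.integral_hasDerivAt_right (hcont.intervalIntegrable _ _)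
      hcont.aestronglyMeasurable.stronglyMeasurableAtFilter hcont.continuousAt
  let k : ℝ → ℝ := fun x => ε⁻¹ * (K (x + ε) - K x)
  have hk : ∀ x, HasDerivAt k (ε⁻¹ * (h (x + ε) - h x)) x := fun x =>
    (((hK (x + ε)).comp_add_const x ε).sub (hK x)).const_mul ε⁻¹
  have hkb : ∀ x, |ε⁻¹ * (h (x + ε) - h x)| ≤ 1 := by
    intro x
    have := hlip (x + ε) x
    rw [add_sub_cancel_left, abs_of_pos hε0] at this
    rw [abs_mul, abs_of_pos (inv_pos.2 hε0), inv_mul_le_iff₀ hε0, mul_one]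
    exact this
  have hclose : ∀ x, |h x - k x| ≤ ε := by
    intro x
    have e1 : K (x + ε) - K x = ∫ t in x..(x + ε), h t :=
      intervalIntegral.integral_interval_sub_left (hcont.intervalIntegrable _ _)
        (hcont.intervalIntegrable _ _)
    have e2 : h x - k x = ε⁻¹ * ∫ t in x..(x + ε), (h x - h t) := by
      rw [intervalIntegral.integral_sub (by simp) (hcont.intervalIntegrable _ _)]
      simp only [k, e1, intervalIntegral.integral_const, add_sub_cancel_left, smul_eq_mul]
      field_simp
    have e3 := intervalIntegral.norm_integral_le_of_norm_le_const (a := x) (b := x + ε)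
      (f := fun t => h x - h t) (C := ε) fun t ht => by
        rw [Set.uIoc_of_le (by linarith)] at ht
        refine (hlip x t).trans ?_
        rw [abs_sub_comm, abs_of_pos (by linarith [ht.1])]
        linarith [ht.2]
    rw [add_sub_cancel_left, abs_of_pos hε0, Real.norm_eq_abs] at e3
    rw [e2, abs_mul, abs_of_pos (inv_pos.2 hε0), inv_mul_le_iff₀ hε0]
    exact e3
  have hkc : Continuous k := continuous_iff_continuousAt.2 fun x => (hk x).continuousAt
  have hint : ∀ (ν : Measure ℝ) [IsProbabilityMeasure ν], Integrable id ν →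
      |(∫ x, h x ∂ν) - ∫ x, k x ∂ν| ≤ ε := by
    intro ν _ hν
    have i1 : Integrable h ν := by
      refine ((integrable_const |h 0|).add hν.abs).mono' hcont.aestronglyMeasurable
        (ae_of_all _ fun x => ?_)
      have := hlip x 0
      have := abs_sub_abs_le_abs_sub (h x) (h 0)
      simp only [sub_zero, Real.norm_eq_abs, Pi.add_apply, id] at *
      linarith
    have i2 : Integrable (fun x => h x - k x) ν :=
      (integrable_const ε).mono' (by fun_prop) (ae_of_all _ hclose)
    have i3 : Integrable k ν := (i1.sub i2).congr (ae_of_all _ fun x => by simp)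
    rw [← integral_sub i1 i3]
    simpa using norm_integral_le_of_norm_le_const (μ := ν) (f := fun x => h x - k x) (C := ε)
      (ae_of_all _ hclose)
  have hkB := H k _ hk (by fun_prop) hkb
  have a1 := hint ν₁ h₁
  have a2 := hint ν₂ h₂
  have htri : |(∫ x, h x ∂ν₁) - ∫ x, h x ∂ν₂| ≤ |(∫ x, k x ∂ν₁) - ∫ x, k x ∂ν₂| + δ := by
    rw [abs_le] at a1 a2 ⊢
    have a3 := neg_abs_le ((∫ x, k x ∂ν₁) - ∫ x, k x ∂ν₂)
    have a4 := le_abs_self ((∫ x, k x ∂ν₁) - ∫ x, k x ∂ν₂)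
    constructor <;> linarith [a1.1, a1.2, a2.1, a2.2]
  calc ENNReal.ofReal |(∫ x, h x ∂ν₁) - ∫ x, h x ∂ν₂|
      ≤ ENNReal.ofReal (|(∫ x, k x ∂ν₁) - ∫ x, k x ∂ν₂| + δ) := ENNReal.ofReal_le_ofReal htri
    _ ≤ B + δ := by
        rw [ENNReal.ofReal_add (abs_nonneg _) (NNReal.coe_nonneg δ), ENNReal.ofReal_coe_nnreal]
        gcongr

/-! ### Chaos expansion for a family of commuting projections -/

section Moebius

variable {A M : Type*} [AddCommGroup M] [Module ℝ M]

/-- The Möbius transform of a function on finite subsets,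
`I ↦ ∑_{K ⊆ I} (-1)^{|I| + |K|} q K`, the sign being that of `(-1)^{|I \ K|}`. -/
def moebius (q : Finset A → M) (I : Finset A) : M :=
  ∑ K ∈ I.powerset, (-1 : ℝ) ^ (I.card + K.card) • q K

lemma moebius_congr {q r : Finset A → M} {I : Finset A} (h : ∀ K ⊆ I, q K = r K) :
    moebius q I = moebius r I :=
  Finset.sum_congr rfl fun K hK => by rw [h K (Finset.mem_powerset.1 hK)]

variable [DecidableEq A]

lemma moebius_insert (q : Finset A → M) {a : A} {I : Finset A} (ha : a ∉ I) :
    moebius q (insert a I) = moebius (fun K => q (insert a K)) I - moebius q I := by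
  unfold moebius
  rw [Finset.sum_powerset_insert ha, Finset.card_insert_of_notMem ha, add_comm, sub_eq_add_neg,
    ← Finset.sum_neg_distrib]
  congr 1
  · refine Finset.sum_congr rfl fun K hK => ?_
    rw [Finset.card_insert_of_notMem (fun h => ha (Finset.mem_powerset.1 hK h))]
    congr 1
    ring
  · refine Finset.sum_congr rfl fun K hK => ?_
    rw [← neg_smul]
    congr 1
    ring

lemma sum_powerset_moebius (q : Finset A → M) (J : Finset A) :
    ∑ I ∈ J.powerset, moebius q I = q J := by
  induction J using Finset.induction_on generalizing q with
  | empty => simp [moebius]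
  | insert a J ha ih =>
    rw [Finset.sum_powerset_insert ha]
    have h1 : ∑ I ∈ J.powerset, moebius q (insert a I)
        = ∑ I ∈ J.powerset, (moebius (fun K => q (insert a K)) I - moebius q I) :=
      Finset.sum_congr rfl fun I hI =>
        moebius_insert q fun h => ha (Finset.mem_powerset.1 hI h)
    rw [h1, Finset.sum_sub_distrib, ih, ih]
    abel

lemma moebius_erase_of_mem (q : Finset A → M) {a : A} {I : Finset A} (ha : a ∈ I) :
    moebius (fun K => q (K.erase a)) I = 0 := by
  rw [← Finset.insert_erase ha, moebius_insert _ (Finset.notMem_erase a I), sub_eq_zero]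
  refine moebius_congr fun K hK => ?_
  have h : a ∉ K := fun h => Finset.notMem_erase a I (hK h)
  rw [Finset.erase_insert h, Finset.erase_eq_of_notMem h]

lemma moebius_erase_of_notMem (q : Finset A → M) {a : A} {I : Finset A} (ha : a ∉ I) :
    moebius (fun K => q (K.erase a)) I = moebius q I :=
  moebius_congr fun K hK => by rw [Finset.erase_eq_of_notMem fun h => ha (hK h)]

end Moebius

section Orthogonal

variable {ι H : Type*} [NormedAddCommGroup H] [InnerProductSpace ℝ H]

lemma norm_sum_sq_of_orthogonal {v : ι → H} (hv : Pairwise fun i j => inner ℝ (v i) (v j) = 0)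
    (s : Finset ι) : ‖∑ i ∈ s, v i‖ ^ 2 = ∑ i ∈ s, ‖v i‖ ^ 2 := by
  classical
  rw [← real_inner_self_eq_norm_sq, sum_inner]
  refine Finset.sum_congr rfl fun i hi => ?_
  rw [inner_sum, Finset.sum_eq_single i (fun j _ hj => hv hj.symm) (fun h => absurd hi h),
    real_inner_self_eq_norm_sq]

lemma summable_of_orthogonal [CompleteSpace H] {v : ι → H}
    (hv : Pairwise fun i j => inner ℝ (v i) (v j) = 0) (hs : Summable fun i => ‖v i‖ ^ 2) :
    Summable v := by
  have hV : OrthogonalFamily ℝ (fun i => (ℝ ∙ v i : Submodule ℝ H))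
      fun i => (ℝ ∙ v i : Submodule ℝ H).subtypeₗᵢ := by
    rintro i j hij ⟨x, hx⟩ ⟨y, hy⟩
    obtain ⟨r, rfl⟩ := Submodule.mem_span_singleton.1 hx
    obtain ⟨t, rfl⟩ := Submodule.mem_span_singleton.1 hy
    simp [inner_smul_left, inner_smul_right, hv hij]
  exact (hV.summable_iff_norm_sq_summable
    (fun i => ⟨v i, Submodule.mem_span_singleton_self (v i)⟩)).2 (by simpa using hs)

lemma norm_sq_eq_tsum_of_orthogonal {v : ι → H} {x : H}
    (hv : Pairwise fun i j => inner ℝ (v i) (v j) = 0) (hx : HasSum v x) :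
    ‖x‖ ^ 2 = ∑' i, ‖v i‖ ^ 2 := by
  have h : HasSum (fun i => ‖v i‖ ^ 2) (‖x‖ ^ 2) := by
    unfold HasSum
    simpa only [norm_sum_sq_of_orthogonal hv] using (Tendsto.norm hx).pow 2
  exact h.tsum_eq.symm

end Orthogonal

section Projections

variable {A H : Type*} [DecidableEq A] [NormedAddCommGroup H] [InnerProductSpace ℝ H]
  {p : A → H →L[ℝ] H} {Q : Finset A → H →L[ℝ] H}

/-- The **Efron–Stein inequality** for finitely many coordinates, in terms of projections: `p a`
removes the coordinate `a`, and `Q J` keeps the coordinates in `J` only. -/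
lemma norm_sq_le_add_sum_norm_sub_sq (hp : ∀ a x y, inner ℝ (p a x) y = inner ℝ x (p a y))
    (hpQ : ∀ a J x, p a (Q J x) = Q (J.erase a) x) (hQp : ∀ a J x, Q J (p a x) = Q (J.erase a) x)
    (hQ : ∀ J x, ‖Q J x‖ ≤ ‖x‖) (x : H) (J : Finset A) :
    ‖Q J x‖ ^ 2 ≤ ‖Q ∅ x‖ ^ 2 + ∑ a ∈ J, ‖x - p a x‖ ^ 2 := by
  induction J using Finset.induction_on with
  | empty => simp
  | insert a J ha ih =>
    have e1 : p a (Q (insert a J) x) = Q J x := by rw [hpQ, Finset.erase_insert ha]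
    have e2 : p a (Q J x) = Q J x := by rw [hpQ, Finset.erase_eq_of_notMem ha]
    have e3 : Q (insert a J) (x - p a x) = Q (insert a J) x - Q J x := by
      rw [map_sub, hQp, Finset.erase_insert ha]
    have horth : inner ℝ (Q J x) (Q (insert a J) x - Q J x) = 0 := by
      have h : inner ℝ (p a (Q J x)) (Q (insert a J) x - Q J x) = 0 := by
        rw [hp, map_sub, e1, e2, sub_self, inner_zero_right]
      rwa [e2] at h
    have hpy := norm_add_sq_eq_norm_sq_add_norm_sq_of_inner_eq_zero _ _ horth
    rw [add_sub_cancel] at hpy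
    have h4 : ‖Q (insert a J) x - Q J x‖ ≤ ‖x - p a x‖ := e3 ▸ hQ _ _
    have h5 := mul_self_le_mul_self (norm_nonneg _) h4
    rw [Finset.sum_insert ha]
    nlinarith

/-- The component of `x` in the chaos indexed by `I`: the part that depends on exactly the
coordinates in `I`. -/
def chaos (Q : Finset A → H →L[ℝ] H) (x : H) (I : Finset A) : H := moebius (fun K => Q K x) I

lemma apply_chaos_of_mem (hpQ : ∀ a J x, p a (Q J x) = Q (J.erase a) x) (x : H) {a : A}
    {I : Finset A} (ha : a ∈ I) : p a (chaos Q x I) = 0 := by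
  rw [← moebius_erase_of_mem (fun K => Q K x) ha]
  simp [chaos, moebius, map_sum, hpQ]

lemma apply_chaos_of_notMem (hpQ : ∀ a J x, p a (Q J x) = Q (J.erase a) x) (x : H) {a : A}
    {I : Finset A} (ha : a ∉ I) : p a (chaos Q x I) = chaos Q x I := by
  unfold chaos
  rw [← moebius_erase_of_notMem (fun K => Q K x) ha]
  simp only [moebius, map_sum, hpQ, map_smul]
  refine Finset.sum_congr rfl fun K _ => ?_
  rw [Finset.erase_right_comm, Finset.erase_idem]

/-- If `a ∈ I \ J`, then `p a` kills the component of `I` and fixes the one of `J`. -/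
lemma chaos_orthogonal (hp : ∀ a x y, inner ℝ (p a x) y = inner ℝ x (p a y))
    (hpQ : ∀ a J x, p a (Q J x) = Q (J.erase a) x) (x : H) :
    Pairwise fun I J => inner ℝ (chaos Q x I) (chaos Q x J) = 0 := by
  have key : ∀ I J : Finset A, ¬ I ⊆ J → inner ℝ (chaos Q x I) (chaos Q x J) = 0 := by
    intro I J h
    obtain ⟨a, haI, haJ⟩ := Finset.not_subset.1 h
    rw [← apply_chaos_of_notMem hpQ x haJ, ← hp, apply_chaos_of_mem hpQ x haI, inner_zero_left]
  intro I J hIJ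
  by_cases h : I ⊆ J
  · rw [real_inner_comm]
    exact key J I fun h' => hIJ (h.antisymm h')
  · exact key I J h

lemma summable_norm_sq_chaos (hp : ∀ a x y, inner ℝ (p a x) y = inner ℝ x (p a y))
    (hpQ : ∀ a J x, p a (Q J x) = Q (J.erase a) x)
    (hQ : ∀ J x, ‖Q J x‖ ≤ ‖x‖) (x : H) : Summable fun I => ‖chaos Q x I‖ ^ 2 := by
  refine summable_of_sum_le (c := ‖x‖ ^ 2) (fun _ => by positivity) fun s => ?_
  have hs : s ⊆ (s.sup id).powerset := fun I hI =>
    Finset.mem_powerset.2 (Finset.le_sup (f := id) hI)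
  calc ∑ I ∈ s, ‖chaos Q x I‖ ^ 2 ≤ ∑ I ∈ (s.sup id).powerset, ‖chaos Q x I‖ ^ 2 :=
        Finset.sum_le_sum_of_subset_of_nonneg hs fun _ _ _ => by positivity
    _ = ‖Q (s.sup id) x‖ ^ 2 := by
        rw [← norm_sum_sq_of_orthogonal (chaos_orthogonal hp hpQ x)]
        unfold chaos
        rw [sum_powerset_moebius]
    _ ≤ ‖x‖ ^ 2 := pow_le_pow_left₀ (norm_nonneg _) (hQ _ _) 2

/-- The chaos expansion converges to `x`, for its partial sums over the subsets of `J` are `Q J x`.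
-/
lemma hasSum_chaos [CompleteSpace H] (hp : ∀ a x y, inner ℝ (p a x) y = inner ℝ x (p a y))
    (hpQ : ∀ a J x, p a (Q J x) = Q (J.erase a) x)
    (hQ : ∀ J x, ‖Q J x‖ ≤ ‖x‖) {x : H} (hx : Tendsto (fun J => Q J x) atTop (𝓝 x)) :
    HasSum (chaos Q x) x := by
  have h1 := (summable_of_orthogonal (chaos_orthogonal hp hpQ x)
    (summable_norm_sq_chaos hp hpQ hQ x)).hasSum
  have h2 := Tendsto.comp h1 tendsto_finset_powerset_atTop_atTop
  have h3 : Tendsto (fun J => Q J x) atTop (𝓝 (∑' I, chaos Q x I)) := by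
    refine h2.congr fun J => ?_
    exact sum_powerset_moebius (fun K => Q K x) J
  rwa [tendsto_nhds_unique h3 hx] at h1

/-- Inversion of the number operator `∑ₐ (1 - pₐ)`, which multiplies the chaos indexed by `I` by
`|I|`: the solution is `G = - ∑_I |I|⁻¹ x_I`, where `|∅|⁻¹ = 0`. -/
lemma exists_tendsto_neg_sum_sub [CompleteSpace H]
    (hp : ∀ a x y, inner ℝ (p a x) y = inner ℝ x (p a y))
    (hpQ : ∀ a J x, p a (Q J x) = Q (J.erase a) x) (hQp : ∀ a J x, Q J (p a x) = Q (J.erase a) x)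
    (hQ : ∀ J x, ‖Q J x‖ ≤ ‖x‖) {x : H} (hx : Tendsto (fun J => Q J x) atTop (𝓝 x))
    (hx0 : Q ∅ x = 0) :
    ∃ G : H, Q ∅ G = 0 ∧ Tendsto (fun J : Finset A => -∑ a ∈ J, (G - p a G)) atTop (𝓝 x) ∧
      ∀ V : Submodule ℝ H, IsClosed (V : Set H) → (∀ J, Q J x ∈ V) → G ∈ V := by
  have horth := chaos_orthogonal hp hpQ x
  have hsq := summable_norm_sq_chaos hp hpQ hQ x
  have horth' : ∀ c : Finset A → ℝ,
      Pairwise fun I J => inner ℝ (c I • chaos Q x I) (c J • chaos Q x J) = 0 := by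
    intro c I J hIJ
    simp [inner_smul_left, inner_smul_right, horth hIJ]
  have hle1 : ∀ I : Finset A, |((I.card : ℝ))⁻¹| ≤ 1 := fun I => by
    rw [abs_of_nonneg (by positivity)]
    exact Nat.cast_inv_le_one _
  have hsumm : Summable fun I : Finset A => (I.card : ℝ)⁻¹ • chaos Q x I := by
    refine summable_of_orthogonal (horth' _) (hsq.of_nonneg_of_le (fun _ => by positivity)
      fun I => ?_)
    rw [norm_smul]
    exact pow_le_pow_left₀ (by positivity)
      (mul_le_of_le_one_left (norm_nonneg _) (hle1 I)) 2
  obtain ⟨G, hG⟩ := hsumm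
  refine ⟨-G, ?_, ?_, fun V hV hJ => V.neg_mem ?_⟩
  · have h1 := (Q ∅).hasSum hG
    have h2 : ∀ I : Finset A, Q ∅ ((I.card : ℝ)⁻¹ • chaos Q x I) = 0 := by
      intro I
      rcases I.eq_empty_or_nonempty with rfl | ⟨a, ha⟩
      · simp
      · have h3 := hQp a ∅ (chaos Q x I)
        rw [apply_chaos_of_mem hpQ x ha, map_zero, Finset.erase_empty] at h3
        rw [map_smul, ← h3, smul_zero]
    simp only [h2] at h1
    rw [map_neg, h1.unique hasSum_zero, neg_zero]
  · have hx' := hasSum_chaos hp hpQ hQ hx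
    have hd : ∀ a, HasSum (fun I : Finset A =>
        (if a ∈ I then (I.card : ℝ)⁻¹ else 0) • chaos Q x I) (G - p a G) := by
      intro a
      refine (hG.sub ((p a).hasSum hG)).congr_fun fun I => ?_
      simp only [map_smul]
      split_ifs with h
      · rw [apply_chaos_of_mem hpQ x h, smul_zero, sub_zero]
      · rw [apply_chaos_of_notMem hpQ x h, sub_self, zero_smul]
    -- The partial sum over `J` has the coefficient `|J ∩ I| / |I|` in the chaos indexed by `I`.
    let c : Finset A → Finset A → ℝ := fun J I =>
      (∑ a ∈ J, if a ∈ I then (I.card : ℝ)⁻¹ else 0) - 1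
    have hcJ : ∀ J I, c J I = ((J ∩ I).card : ℝ) * (I.card : ℝ)⁻¹ - 1 := by
      intro J I
      simp only [c]
      rw [← Finset.sum_filter, Finset.sum_const, nsmul_eq_mul, Finset.filter_mem_eq_inter]
    have hJ : ∀ J : Finset A, HasSum (fun I => c J I • chaos Q x I)
        (∑ a ∈ J, (G - p a G) - x) := by
      intro J
      refine ((hasSum_sum fun a _ => hd a).sub hx').congr_fun fun I => ?_
      simp only [c, sub_smul, one_smul, Finset.sum_smul]
    have hnorm : ∀ J : Finset A, ‖∑ a ∈ J, (G - p a G) - x‖ ^ 2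
        = ∑' I, ‖c J I • chaos Q x I‖ ^ 2 := fun J =>
      norm_sq_eq_tsum_of_orthogonal (horth' _) (hJ J)
    have hlim : Tendsto (fun J : Finset A => ∑' I, ‖c J I • chaos Q x I‖ ^ 2) atTop
        (𝓝 (∑' _ : Finset A, (0 : ℝ))) := by
      refine tendsto_tsum_of_dominated_convergence hsq (fun I => ?_)
        (Eventually.of_forall fun J I => ?_)
      · refine tendsto_const_nhds.congr' ?_
        filter_upwards [eventually_ge_atTop I] with J hIJ
        rcases I.eq_empty_or_nonempty with rfl | hne
        · simp [chaos, moebius, hx0]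
        · have : (I.card : ℝ) ≠ 0 := by exact_mod_cast hne.card_pos.ne'
          rw [hcJ, Finset.inter_eq_right.2 hIJ, mul_inv_cancel₀ this]
          simp
      · rw [Real.norm_eq_abs, abs_of_nonneg (by positivity), norm_smul]
        refine pow_le_pow_left₀ (by positivity) (mul_le_of_le_one_left (norm_nonneg _) ?_) 2
        have h1 : ((J ∩ I).card : ℝ) * (I.card : ℝ)⁻¹ ≤ 1 := by
          rw [← div_eq_mul_inv]
          exact div_le_one_of_le₀ (by exact_mod_cast Finset.card_le_card Finset.inter_subset_right)
            (by positivity)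
        have h2 : 0 ≤ ((J ∩ I).card : ℝ) * (I.card : ℝ)⁻¹ := by positivity
        rw [hcJ, Real.norm_eq_abs, abs_le]
        constructor <;> linarith
    simp only [tsum_zero, ← hnorm] at hlim
    have hlim2 : Tendsto (fun J : Finset A => ‖∑ a ∈ J, (G - p a G) - x‖) atTop (𝓝 0) := by
      have := hlim.sqrt
      simpa using this
    rw [tendsto_iff_norm_sub_tendsto_zero]
    refine hlim2.congr fun J => ?_
    congr 2
    rw [← Finset.sum_neg_distrib]
    refine Finset.sum_congr rfl fun a _ => ?_
    rw [map_neg]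
    abel
  · refine hV.mem_of_tendsto hG (Eventually.of_forall fun s => V.sum_mem fun I _ => V.smul_mem _ ?_)
    exact V.sum_mem fun K _ => V.smul_mem _ (hJ K)

end Projections

/-! ### Resampling one coordinate -/

section Resampling

variable {Ω A E₀ : Type*} {E : A → Type*} [mΩ : MeasurableSpace Ω] [MeasurableSpace E₀]
  [∀ a, MeasurableSpace (E a)] {Z : Ω → E₀} {X : ∀ a, Ω → E a}

/-- The σ-field `σ(Z) ∨ σ(X_b, b ∈ S)`. -/
abbrev sigmaOn (Z : Ω → E₀) (X : ∀ a, Ω → E a) (S : Set A) : MeasurableSpace Ω :=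
  sigmaZ Z ⊔ ⨆ b ∈ S, MeasurableSpace.comap (X b) inferInstance

lemma sigmaWithout_eq_sigmaOn (a : A) : sigmaWithout Z X a = sigmaOn Z X {a}ᶜ := by
  unfold sigmaWithout sigmaOn
  rw [iSup_subtype]
  rfl

lemma sigmaOn_empty : sigmaOn Z X ∅ = sigmaZ Z := by simp [sigmaOn]

lemma sigmaOn_mono {S T : Set A} (h : S ⊆ T) : sigmaOn Z X S ≤ sigmaOn Z X T :=
  sup_le_sup_left (biSup_mono fun _ hb => h hb) _

lemma sigmaOn_le (hZ : Measurable Z) (hX : ∀ a, Measurable (X a)) (S : Set A) :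
    sigmaOn Z X S ≤ mΩ :=
  sup_le hZ.comap_le (iSup₂_le fun b _ => (hX b).comap_le)

lemma measurable_sigmaOn_left (S : Set A) : Measurable[sigmaOn Z X S] Z :=
  Measurable.of_comap_le le_sup_left

lemma measurable_sigmaOn_right {S : Set A} {b : A} (hb : b ∈ S) :
    Measurable[sigmaOn Z X S] (X b) :=
  Measurable.of_comap_le ((le_biSup (fun b => MeasurableSpace.comap (X b) inferInstance) hb).trans
    le_sup_right)

lemma comap_pi_eq_iSup (S : Set A) :
    MeasurableSpace.comap (fun ω (b : S) => X b ω) MeasurableSpace.pi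
      = ⨆ b ∈ S, MeasurableSpace.comap (X b) inferInstance := by
  rw [MeasurableSpace.pi, MeasurableSpace.comap_iSup, iSup_subtype']
  simp only [MeasurableSpace.comap_comp]
  rfl

lemma sigmaOn_eq_comap (S : Set A) :
    sigmaOn Z X S = MeasurableSpace.comap (fun ω => (Z ω, fun b : S => X b ω)) inferInstance := by
  refine Eq.trans ?_ (MeasurableSpace.comap_prodMk Z (fun ω (b : S) => X b ω)).symm
  rw [comap_pi_eq_iSup]

lemma stronglyMeasurable_integral_kernel {Ω' Y : Type*} {m : MeasurableSpace Ω'}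
    [MeasurableSpace Y] (κ : Kernel E₀ Y) [IsMarkovKernel κ] {V : Ω' → E₀} (hV : Measurable V)
    {k : Ω' × Y → ℝ} (hk : StronglyMeasurable k) :
    StronglyMeasurable fun ω => ∫ y, k (ω, y) ∂(κ (V ω)) :=
  hk.integral_kernel_prod_right' (κ := κ.comap V hV)

variable [StandardBorelSpace Ω] [∀ a, StandardBorelSpace (E a)] [∀ a, Nonempty (E a)]
  {μ : Measure Ω} [IsProbabilityMeasure μ]

/-- The remaining coordinates are conditionally independent of `Xₐ`. -/
lemma condIndepFun_compl (hZ : Measurable Z) (hX : ∀ a, Measurable (X a))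
    (hindep : iCondIndepFun (sigmaZ Z) hZ.comap_le X μ) (a : A) :
    CondIndepFun (sigmaZ Z) hZ.comap_le (fun ω (b : ({a}ᶜ : Set A)) => X b ω) (X a) μ := by
  rw [condIndepFun_iff_condIndep]
  rw [iCondIndepFun_iff_iCondIndep] at hindep
  have h := condIndep_iSup_of_disjoint (fun i => (hX i).comap_le) hindep
    (S := {a}ᶜ) (T := {a}) disjoint_compl_left
  rw [iSup_singleton, ← comap_pi_eq_iSup] at h
  exact h

/-- The law of `((Z, X), X'ₐ)`, where `X'ₐ` is a conditionally independent copy of `Xₐ` given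
`Z`. -/
def copyLaw (μ : Measure Ω) [IsFiniteMeasure μ] (Z : Ω → E₀) (X : ∀ a, Ω → E a) (a : A) :
    Measure ((E₀ × ∀ a, E a) × E a) :=
  μ.map (fun ω => (Z ω, fun b => X b ω)) ⊗ₘ (condDistrib (X a) Z μ).prodMkRight _

instance (a : A) : IsFiniteMeasure (copyLaw μ Z X a) := by
  unfold copyLaw
  infer_instance

open Classical in
/-- The map exchanging the `a`-th coordinate with its copy. -/
def swapCopy (a : A) (q : (E₀ × ∀ a, E a) × E a) : (E₀ × ∀ a, E a) × E a :=
  ((q.1.1, Function.update q.1.2 a q.2), q.1.2 a)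

lemma measurable_swapCopy (a : A) : Measurable (swapCopy (E₀ := E₀) (E := E) a) := by
  classical
  unfold swapCopy
  have : Measurable fun q : (E₀ × ∀ a, E a) × E a => Function.update q.1.2 a q.2 := by
    refine measurable_pi_iff.2 fun b => ?_
    by_cases h : b = a
    · subst h
      simpa using measurable_snd
    · simp only [Function.update_of_ne h]
      fun_prop
  fun_prop

lemma measurable_point (hZ : Measurable Z) (hX : ∀ a, Measurable (X a)) :
    Measurable fun ω => (Z ω, fun b => X b ω) := by fun_prop

lemma lintegral_copyLaw (hZ : Measurable Z) (hX : ∀ a, Measurable (X a)) (a : A)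
    {K : (E₀ × ∀ a, E a) × E a → ℝ≥0∞} (hK : Measurable K) :
    ∫⁻ q, K q ∂(copyLaw μ Z X a)
      = ∫⁻ ω, ∫⁻ y, K ((Z ω, fun b => X b ω), y) ∂(condDistrib (X a) Z μ (Z ω)) ∂μ := by
  unfold copyLaw
  rw [Measure.lintegral_compProd hK, lintegral_map ?_ (measurable_point hZ hX)]
  · rfl
  · exact hK.lintegral_kernel_prod_right'

/-- Given `Z` and the other coordinates, `Xₐ` has its conditional law given `Z`. -/
lemma map_compl_eq_compProd [Countable A] (hZ : Measurable Z) (hX : ∀ a, Measurable (X a))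
    (hindep : iCondIndepFun (sigmaZ Z) hZ.comap_le X μ) (a : A) :
    μ.map (fun ω => ((Z ω, fun b : ({a}ᶜ : Set A) => X b ω), X a ω))
      = μ.map (fun ω => (Z ω, fun b : ({a}ᶜ : Set A) => X b ω))
        ⊗ₘ (condDistrib (X a) Z μ).prodMkRight _ := by
  have hW : Measurable fun ω (b : ({a}ᶜ : Set A)) => X b ω := by fun_prop
  have h := (condIndepFun_iff_condDistrib_prod_ae_eq_prodMkRight (μ := μ) (hX a) hW hZ).1
    (condIndepFun_compl hZ hX hindep a)
  rwa [condDistrib_ae_eq_iff_measure_eq_compProd _ (hX a).aemeasurable] at h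

open Classical in
/-- The point of `∏ₐ Eₐ` with the given `a`-th coordinate and the given other coordinates. -/
def glue (a : A) (w : ∀ b : ({a}ᶜ : Set A), E b) (x : E a) : ∀ b, E b :=
  fun b => if h : b = a then h ▸ x else w ⟨b, h⟩

lemma measurable_glue (a : A) :
    Measurable fun q : (∀ b : ({a}ᶜ : Set A), E b) × E a => glue a q.1 q.2 := by
  refine measurable_pi_iff.2 fun b => ?_
  unfold glue
  by_cases h : b = a
  · subst h
    simpa using measurable_snd
  · simp only [h, dif_neg, not_false_eq_true]
    fun_prop

lemma glue_restrict (a : A) (x : ∀ b, E b) :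
    glue a (fun b : ({a}ᶜ : Set A) => x b) (x a) = x := by
  ext b
  unfold glue
  split_ifs with h
  · subst h
    rfl
  · rfl

open Classical in
lemma update_glue (a : A) (w : ∀ b : ({a}ᶜ : Set A), E b) (x y : E a) :
    Function.update (glue a w x) a y = glue a w y := by
  ext b
  by_cases h : b = a
  · subst h
    simp [glue]
  · simp [glue, h]

lemma glue_self (a : A) (w : ∀ b : ({a}ᶜ : Set A), E b) (x : E a) : glue a w x a = x := by
  simp [glue]

/-- Exchangeability: `Xₐ` and its copy are conditionally independent and identically distributed
given `Z` and the other coordinates. -/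
lemma map_swapCopy_copyLaw [Countable A] (hZ : Measurable Z) (hX : ∀ a, Measurable (X a))
    (hindep : iCondIndepFun (sigmaZ Z) hZ.comap_le X μ) (a : A) :
    (copyLaw μ Z X a).map (swapCopy a) = copyLaw μ Z X a := by
  set κ := condDistrib (X a) Z μ with hκ
  set ξ := μ.map (fun ω => (Z ω, fun b : ({a}ᶜ : Set A) => X b ω)) with hξ
  have hg := measurable_glue (E := E) a
  have key : ∀ K : (E₀ × ∀ a, E a) × E a → ℝ≥0∞, Measurable K →
      ∫⁻ q, K q ∂(copyLaw μ Z X a)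
        = ∫⁻ r, ∫⁻ x, ∫⁻ y, K ((r.1, glue a r.2 x), y) ∂(κ r.1) ∂(κ r.1) ∂ξ := by
    intro K hK
    let Φ : (E₀ × (∀ b : ({a}ᶜ : Set A), E b)) × E a → ℝ≥0∞ := fun s =>
      ∫⁻ y, K ((s.1.1, glue a s.1.2 s.2), y) ∂(κ s.1.1)
    have hΦ : Measurable Φ := by
      have : Measurable fun q : ((E₀ × (∀ b : ({a}ᶜ : Set A), E b)) × E a) × E a =>
          K ((q.1.1.1, glue a q.1.1.2 q.1.2), q.2) := by
        refine hK.comp (Measurable.prodMk (Measurable.prodMk (by fun_prop) ?_) (by fun_prop))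
        exact hg.comp (Measurable.prodMk (by fun_prop) (by fun_prop))
      exact this.lintegral_kernel_prod_right'
        (κ := κ.comap (fun s : (E₀ × (∀ b : ({a}ᶜ : Set A), E b)) × E a => s.1.1) (by fun_prop))
    have h1 : ∫⁻ q, K q ∂(copyLaw μ Z X a)
        = ∫⁻ s, Φ s ∂(μ.map (fun ω => ((Z ω, fun b : ({a}ᶜ : Set A) => X b ω), X a ω))) := by
      rw [lintegral_map hΦ (by fun_prop), lintegral_copyLaw hZ hX a hK]
      refine lintegral_congr fun ω => ?_
      simp only [Φ]
      rw [glue_restrict a (fun b => X b ω)]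
    rw [h1, map_compl_eq_compProd hZ hX hindep, Measure.lintegral_compProd hΦ]
    rfl
  refine Measure.ext_of_lintegral _ fun K hK => ?_
  rw [lintegral_map hK (measurable_swapCopy a),
    key (fun q => K (swapCopy a q)) (hK.comp (measurable_swapCopy a)), key K hK]
  refine lintegral_congr fun r => ?_
  have hm : Measurable fun q : E a × E a => K ((r.1, glue a r.2 q.1), q.2) := by
    refine hK.comp (Measurable.prodMk (Measurable.prodMk measurable_const ?_) measurable_snd)
    exact hg.comp (Measurable.prodMk measurable_const measurable_fst)
  simp only [swapCopy, update_glue, glue_self]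
  exact (lintegral_lintegral_swap hm.aemeasurable).symm

lemma measurePreserving_swapCopy [Countable A] (hZ : Measurable Z) (hX : ∀ a, Measurable (X a))
    (hindep : iCondIndepFun (sigmaZ Z) hZ.comap_le X μ) (a : A) :
    MeasurePreserving (swapCopy a) (copyLaw μ Z X a) (copyLaw μ Z X a) :=
  ⟨measurable_swapCopy a, map_swapCopy_copyLaw hZ hX hindep a⟩

lemma measurePreserving_fst_copyLaw (a : A) :
    MeasurePreserving Prod.fst (copyLaw μ Z X a) (μ.map fun ω => (Z ω, fun b => X b ω)) :=
  ⟨measurable_fst, Measure.fst_compProd _ _⟩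

end Resampling

/-! ### Conditional expectation as integration over a copy -/

section Averaging

variable {Ω A E₀ : Type*} {E : A → Type*} [mΩ : MeasurableSpace Ω] [MeasurableSpace E₀]
  [∀ a, MeasurableSpace (E a)] {Z : Ω → E₀} {X : ∀ a, Ω → E a}

lemma swapCopy_swapCopy (a : A) (q : (E₀ × ∀ a, E a) × E a) :
    swapCopy a (swapCopy a q) = q := by
  simp [swapCopy]

variable [StandardBorelSpace Ω] [∀ a, StandardBorelSpace (E a)] [∀ a, Nonempty (E a)]
  {μ : Measure Ω} [IsProbabilityMeasure μ]

lemma memLp_fst_copyLaw (hZ : Measurable Z) (hX : ∀ a, Measurable (X a)) (a : A)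
    {f : E₀ × (∀ a, E a) → ℝ} (hf : Measurable f) {r : ℝ≥0∞} (hF : MemLp (functional Z X f) r μ) :
    MemLp (fun q => f q.1) r (copyLaw μ Z X a) :=
  ((memLp_map_measure_iff hf.aestronglyMeasurable (measurable_point hZ hX).aemeasurable).2
    hF).comp_measurePreserving (measurePreserving_fst_copyLaw a)

lemma memLp_swapCopy_copyLaw [Countable A] (hZ : Measurable Z) (hX : ∀ a, Measurable (X a))
    (hindep : iCondIndepFun (sigmaZ Z) hZ.comap_le X μ) (a : A)
    {f : E₀ × (∀ a, E a) → ℝ} (hf : Measurable f) {r : ℝ≥0∞} (hF : MemLp (functional Z X f) r μ) :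
    MemLp (fun q => f (swapCopy a q).1) r (copyLaw μ Z X a) :=
  (memLp_fst_copyLaw hZ hX a hf hF).comp_measurePreserving
    (measurePreserving_swapCopy hZ hX hindep a)

lemma integral_fst_copyLaw (hZ : Measurable Z) (hX : ∀ a, Measurable (X a)) (a : A)
    {f : E₀ × (∀ a, E a) → ℝ} (hf : Measurable f) :
    ∫ q, f q.1 ∂(copyLaw μ Z X a) = ∫ ω, functional Z X f ω ∂μ := by
  have h := integral_map (μ := copyLaw μ Z X a) measurable_fst.aemeasurable
    (f := f) hf.aestronglyMeasurable
  rw [← h, (measurePreserving_fst_copyLaw a).map_eq,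
    integral_map (measurable_point hZ hX).aemeasurable hf.aestronglyMeasurable]
  rfl

lemma integral_comp_swapCopy [Countable A] (hZ : Measurable Z) (hX : ∀ a, Measurable (X a))
    (hindep : iCondIndepFun (sigmaZ Z) hZ.comap_le X μ) (a : A)
    {K : (E₀ × ∀ a, E a) × E a → ℝ} (hK : Measurable K) :
    ∫ q, K (swapCopy a q) ∂(copyLaw μ Z X a) = ∫ q, K q ∂(copyLaw μ Z X a) := by
  conv_rhs => rw [← map_swapCopy_copyLaw hZ hX hindep a]
  rw [integral_map (measurable_swapCopy a).aemeasurable hK.aestronglyMeasurable]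

/-- Averaging over the copy: `E[f(Z, X^{(a)}) | Z, X]` as a function of `(Z, X)`. -/
def avgCopy (μ : Measure Ω) [IsFiniteMeasure μ] (Z : Ω → E₀) (X : ∀ a, Ω → E a) (a : A)
    (f : E₀ × (∀ a, E a) → ℝ) : E₀ × (∀ a, E a) → ℝ :=
  fun p => ∫ y, f (swapCopy a (p, y)).1 ∂(condDistrib (X a) Z μ p.1)

lemma measurable_avgCopy (a : A) {f : E₀ × (∀ a, E a) → ℝ} (hf : Measurable f) :
    Measurable (avgCopy μ Z X a f) :=
  (stronglyMeasurable_integral_kernel (condDistrib (X a) Z μ) measurable_fst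
    (hf.comp (measurable_fst.comp (measurable_swapCopy a))).stronglyMeasurable).measurable

lemma integrable_avgCopy_mul (hZ : Measurable Z) (hX : ∀ a, Measurable (X a)) (a : A)
    {f w : E₀ × (∀ a, E a) → ℝ} (hf : Measurable f) (hw : Measurable w)
    (hfw : Integrable (fun q => f (swapCopy a q).1 * w q.1) (copyLaw μ Z X a)) :
    Integrable (fun ω => functional Z X (avgCopy μ Z X a f) ω * functional Z X w ω) μ := by
  have h : Integrable (fun p => ∫ y, f (swapCopy a (p, y)).1 * w p
      ∂((condDistrib (X a) Z μ).prodMkRight _ p)) (μ.map fun ω => (Z ω, fun b => X b ω)) :=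
    Integrable.integral_compProd (κ := Kernel.const Unit _) (a := ()) hfw
  simp only [integral_mul_const] at h
  exact (integrable_map_measure
    (((measurable_avgCopy a hf).mul hw).aestronglyMeasurable)
    (measurable_point hZ hX).aemeasurable).1 h

lemma integral_avgCopy_mul (hZ : Measurable Z) (hX : ∀ a, Measurable (X a)) (a : A)
    {f w : E₀ × (∀ a, E a) → ℝ} (hf : Measurable f) (hw : Measurable w)
    (hfw : Integrable (fun q => f (swapCopy a q).1 * w q.1) (copyLaw μ Z X a)) :
    ∫ ω, functional Z X (avgCopy μ Z X a f) ω * functional Z X w ω ∂μ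
      = ∫ q, f (swapCopy a q).1 * w q.1 ∂(copyLaw μ Z X a) := by
  have h := Measure.integral_compProd hfw
  simp only [integral_mul_const] at h
  refine Eq.trans ?_ h.symm
  exact (integral_map (measurable_point hZ hX).aemeasurable
    (((measurable_avgCopy a hf).mul hw).aestronglyMeasurable)).symm

/-- If `f(Z, X)` depends on `Z` and the coordinates in `insert a S` only, then averaging over the
`a`-th coordinate leaves a function of `Z` and the coordinates in `S`. -/
lemma stronglyMeasurable_functional_avgCopy (a : A) {S T : Set A} (hT : T ⊆ insert a S)
    {h : E₀ × (∀ b : T, E b) → ℝ} (hh : Measurable h) :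
    StronglyMeasurable[sigmaOn Z X (S \ {a})]
      (functional Z X (avgCopy μ Z X a fun p => h (p.1, fun b : T => p.2 b))) := by
  refine @stronglyMeasurable_integral_kernel E₀ _ Ω (E a) (sigmaOn Z X (S \ {a})) _
    (condDistrib (X a) Z μ) _ Z (measurable_sigmaOn_left _)
    (fun r => h (Z r.1, fun b : T => (swapCopy a ((Z r.1, fun b => X b r.1), r.2)).1.2 b)) ?_
  let _ := sigmaOn Z X (S \ {a})
  refine (hh.comp (Measurable.prodMk ((measurable_sigmaOn_left (S \ {a})).comp measurable_fst)
    (measurable_pi_iff.2 fun b => ?_))).stronglyMeasurable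
  classical
  by_cases hb : (b : A) = a
  · obtain ⟨b, hbT⟩ := b
    dsimp only at hb
    subst hb
    simpa [swapCopy] using measurable_snd
  · simp only [swapCopy, Function.update_of_ne hb]
    exact (measurable_sigmaOn_right (S := S \ {a})
      ⟨(hT b.2).resolve_left hb, hb⟩).comp measurable_fst

/-- `E[F | 𝒢ᵃ]` is the average of `F` over the copy of `Xₐ`: a test function of `Z` and the other
coordinates is invariant under the exchange. -/
lemma condExp_sigmaWithout_eq_avgCopy [Countable A] (hZ : Measurable Z)
    (hX : ∀ a, Measurable (X a))
    (hindep : iCondIndepFun (sigmaZ Z) hZ.comap_le X μ) (a : A)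
    {f : E₀ × (∀ a, E a) → ℝ} (hf : Measurable f) (hF : Integrable (functional Z X f) μ) :
    μ[functional Z X f | sigmaWithout Z X a] =ᵐ[μ] functional Z X (avgCopy μ Z X a f) := by
  have hm : sigmaOn Z X {a}ᶜ ≤ mΩ := sigmaOn_le hZ hX _
  have hF1 : MemLp (functional Z X f) 1 μ := memLp_one_iff_integrable.2 hF
  have hswap : Integrable (fun q => f (swapCopy a q).1) (copyLaw μ Z X a) :=
    memLp_one_iff_integrable.1 (memLp_swapCopy_copyLaw hZ hX hindep a hf hF1)
  rw [sigmaWithout_eq_sigmaOn]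
  symm
  refine ae_eq_condExp_of_forall_setIntegral_eq hm hF (fun s _ _ => ?_) (fun s hs _ => ?_) ?_
  · have h := integrable_avgCopy_mul hZ hX a hf (w := fun _ => 1) measurable_const
      (by simpa using hswap)
    exact (h.congr (ae_of_all _ fun ω => by simp [functional])).integrableOn
  · rw [sigmaOn_eq_comap] at hs
    obtain ⟨t, ht, rfl⟩ := hs
    let w : E₀ × (∀ a, E a) → ℝ := fun p =>
      t.indicator (fun _ => 1) (p.1, fun b : ({a}ᶜ : Set A) => p.2 b)
    have hw : Measurable w := (measurable_const.indicator ht).comp (by fun_prop)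
    have hwb : ∀ p, ‖w p‖ ≤ 1 := fun p => by
      simp only [w, Set.indicator]
      split_ifs <;> simp
    have hwswap : ∀ q : (E₀ × ∀ a, E a) × E a, w (swapCopy a q).1 = w q.1 := by
      intro q
      have : (fun b : ({a}ᶜ : Set A) => (swapCopy a q).1.2 b)
          = fun b : ({a}ᶜ : Set A) => q.1.2 b := by
        classical
        ext b
        simp [swapCopy, Function.update_of_ne (show (b : A) ≠ a from b.2)]
      simp only [w, this]
      rfl
    have hind : ∀ g : Ω → ℝ, ∫ ω in (fun ω => (Z ω, fun b : ({a}ᶜ : Set A) => X b ω)) ⁻¹' t,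
        g ω ∂μ = ∫ ω, g ω * functional Z X w ω ∂μ := by
      intro g
      rw [← integral_indicator ((show Measurable fun ω =>
        (Z ω, fun b : ({a}ᶜ : Set A) => X b ω) by fun_prop) ht)]
      refine integral_congr_ae (ae_of_all _ fun ω => ?_)
      by_cases h : (Z ω, fun b : ({a}ᶜ : Set A) => X b ω) ∈ t
      · simp [functional, w, Set.indicator, h]
      · simp [functional, w, Set.indicator, h]
    have hfw : Integrable (fun q => f (swapCopy a q).1 * w q.1) (copyLaw μ Z X a) :=
      hswap.mul_bdd (hw.comp measurable_fst).aestronglyMeasurable (ae_of_all _ fun q => hwb q.1)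
    rw [hind, hind, integral_avgCopy_mul hZ hX a hf hw hfw]
    calc ∫ q, f (swapCopy a q).1 * w q.1 ∂(copyLaw μ Z X a)
        = ∫ q, (fun q => f q.1 * w q.1) (swapCopy a q) ∂(copyLaw μ Z X a) := by
          simp only [hwswap]
      _ = ∫ q, f q.1 * w q.1 ∂(copyLaw μ Z X a) :=
          integral_comp_swapCopy hZ hX hindep a
            ((hf.comp measurable_fst).mul (hw.comp measurable_fst))
      _ = _ := integral_fst_copyLaw hZ hX a (hf.mul hw)
  · have h := stronglyMeasurable_functional_avgCopy (μ := μ) (Z := Z) (X := X) a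
      (S := {a}ᶜ) (T := Set.univ) (h := fun r => f (r.1, fun b => r.2 ⟨b, trivial⟩))
      (fun b _ => or_iff_not_imp_left.2 id) (hf.comp (by fun_prop))
    rw [show ({a}ᶜ : Set A) \ {a} = {a}ᶜ by simp] at h
    exact h.aestronglyMeasurable

/-- `E[E[F | σ(Z, X_b, b ∈ S)] | 𝒢ᵃ] = E[F | σ(Z, X_b, b ∈ S \ {a})]`. -/
lemma condExp_sigmaWithout_condExp_sigmaOn [Countable A] (hZ : Measurable Z)
    (hX : ∀ a, Measurable (X a))
    (hindep : iCondIndepFun (sigmaZ Z) hZ.comap_le X μ) (a : A) (S : Set A) (F : Ω → ℝ) :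
    μ[μ[F | sigmaOn Z X S] | sigmaWithout Z X a] =ᵐ[μ] μ[F | sigmaOn Z X (S \ {a})] := by
  have hS := sigmaOn_le hZ hX S
  have hSa := sigmaOn_le hZ hX (S \ {a})
  have ha : sigmaWithout Z X a ≤ mΩ := sigmaWithout_eq_sigmaOn (Z := Z) (X := X) a ▸
    sigmaOn_le hZ hX _
  have hle : sigmaOn Z X (S \ {a}) ≤ sigmaWithout Z X a := by
    rw [sigmaWithout_eq_sigmaOn]
    exact sigmaOn_mono fun b hb => hb.2
  have hle' : sigmaOn Z X (S \ {a}) ≤ sigmaOn Z X S := sigmaOn_mono Set.sdiff_subset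
  have hsm : StronglyMeasurable[sigmaOn Z X S] (μ[F | sigmaOn Z X S]) :=
    stronglyMeasurable_condExp
  have hint : Integrable (μ[F | sigmaOn Z X S]) μ := integrable_condExp
  obtain ⟨h, hh, heq⟩ : ∃ h : E₀ × (∀ b : S, E b) → ℝ, StronglyMeasurable h ∧
      μ[F | sigmaOn Z X S] = h ∘ fun ω => (Z ω, fun b : S => X b ω) := by
    refine StronglyMeasurable.exists_eq_measurable_comp ?_
    convert hsm
    exact (sigmaOn_eq_comap S).symm
  let f : E₀ × (∀ a, E a) → ℝ := fun p => h (p.1, fun b : S => p.2 b)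
  have hf : Measurable f := hh.measurable.comp (by fun_prop)
  have hfF : μ[F | sigmaOn Z X S] = functional Z X f := heq
  rw [hfF] at hint
  have h1 := condExp_sigmaWithout_eq_avgCopy hZ hX hindep a hf hint
  rw [← hfF] at h1
  have h2 : StronglyMeasurable[sigmaOn Z X (S \ {a})] (functional Z X (avgCopy μ Z X a f)) :=
    stronglyMeasurable_functional_avgCopy a (Set.subset_insert a S) hh.measurable
  have h3 : Integrable (functional Z X (avgCopy μ Z X a f)) μ := integrable_condExp.congr h1
  calc μ[μ[F | sigmaOn Z X S] | sigmaWithout Z X a]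
      =ᵐ[μ] functional Z X (avgCopy μ Z X a f) := h1
    _ = μ[functional Z X (avgCopy μ Z X a f) | sigmaOn Z X (S \ {a})] :=
        (condExp_of_stronglyMeasurable hSa h2 h3).symm
    _ =ᵐ[μ] μ[μ[μ[F | sigmaOn Z X S] | sigmaWithout Z X a] | sigmaOn Z X (S \ {a})] :=
        condExp_congr_ae h1.symm
    _ =ᵐ[μ] μ[μ[F | sigmaOn Z X S] | sigmaOn Z X (S \ {a})] := condExp_condExp_of_le hle ha
    _ =ᵐ[μ] μ[F | sigmaOn Z X (S \ {a})] := condExp_condExp_of_le hle' hS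

end Averaging

/-! ### Integration by parts for the discrete gradient -/

section Gradient

variable {Ω A E₀ : Type*} {E : A → Type*} [mΩ : MeasurableSpace Ω] [MeasurableSpace E₀]
  [∀ a, MeasurableSpace (E a)] {Z : Ω → E₀} {X : ∀ a, Ω → E a}
  [StandardBorelSpace Ω] [∀ a, StandardBorelSpace (E a)] [∀ a, Nonempty (E a)]
  {μ : Measure Ω} [IsProbabilityMeasure μ]

lemma measurable_functional (hZ : Measurable Z) (hX : ∀ a, Measurable (X a))
    {f : E₀ × (∀ a, E a) → ℝ} (hf : Measurable f) : Measurable (functional Z X f) :=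
  hf.comp (measurable_point hZ hX)

lemma measurable_comp_swapCopy (a : A) {f : E₀ × (∀ a, E a) → ℝ} (hf : Measurable f) :
    Measurable fun q : (E₀ × ∀ a, E a) × E a => f (swapCopy a q).1 :=
  hf.comp (measurable_fst.comp (measurable_swapCopy a))

lemma grad_ae_eq [Countable A] (hZ : Measurable Z) (hX : ∀ a, Measurable (X a))
    (hindep : iCondIndepFun (sigmaZ Z) hZ.comap_le X μ) (a : A)
    {f : E₀ × (∀ a, E a) → ℝ} (hf : Measurable f) (hF : Integrable (functional Z X f) μ) :
    grad μ Z X a (functional Z X f)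
      =ᵐ[μ] functional Z X f - functional Z X (avgCopy μ Z X a f) :=
  (EventuallyEq.refl _ _).sub (condExp_sigmaWithout_eq_avgCopy hZ hX hindep a hf hF)

lemma memLp_grad {a : A} {F : Ω → ℝ} (hF : MemLp F 2 μ) : MemLp (grad μ Z X a F) 2 μ :=
  hF.sub (hF.condExp one_le_two)

/-- Integration by parts: `E[Dₐ F · U] = ½ E[Δᵃ F · Δᵃ U]`. -/
lemma integral_grad_mul [Countable A] (hZ : Measurable Z) (hX : ∀ a, Measurable (X a))
    (hindep : iCondIndepFun (sigmaZ Z) hZ.comap_le X μ) (a : A)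
    {f u : E₀ × (∀ a, E a) → ℝ} (hf : Measurable f) (hu : Measurable u)
    (hF : MemLp (functional Z X f) 2 μ) (hU : MemLp (functional Z X u) 2 μ) :
    ∫ ω, grad μ Z X a (functional Z X f) ω * functional Z X u ω ∂μ
      = (1 / 2) * ∫ q, diffOp f a q.1 q.2 * diffOp u a q.1 q.2 ∂(copyLaw μ Z X a) := by
  have f1 := memLp_fst_copyLaw hZ hX a hf hF
  have u1 := memLp_fst_copyLaw hZ hX a hu hU
  have f2 := memLp_swapCopy_copyLaw hZ hX hindep a hf hF
  have u2 := memLp_swapCopy_copyLaw hZ hX hindep a hu hU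
  have i11 := f1.integrable_mul u1
  have i21 := f2.integrable_mul u1
  have i12 := f1.integrable_mul u2
  have i22 := f2.integrable_mul u2
  have e22 : ∫ q, f (swapCopy a q).1 * u (swapCopy a q).1 ∂(copyLaw μ Z X a)
      = ∫ q, f q.1 * u q.1 ∂(copyLaw μ Z X a) :=
    integral_comp_swapCopy hZ hX hindep a (K := fun q => f q.1 * u q.1)
      ((hf.comp measurable_fst).mul (hu.comp measurable_fst))
  have e12 : ∫ q, f q.1 * u (swapCopy a q).1 ∂(copyLaw μ Z X a)
      = ∫ q, f (swapCopy a q).1 * u q.1 ∂(copyLaw μ Z X a) := by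
    rw [← integral_comp_swapCopy hZ hX hindep a (K := fun q => f (swapCopy a q).1 * u q.1)
      ((measurable_comp_swapCopy a hf).mul (hu.comp measurable_fst))]
    simp only [swapCopy_swapCopy]
  have hL : ∫ ω, grad μ Z X a (functional Z X f) ω * functional Z X u ω ∂μ
      = (∫ q, f q.1 * u q.1 ∂(copyLaw μ Z X a))
        - ∫ q, f (swapCopy a q).1 * u q.1 ∂(copyLaw μ Z X a) := by
    rw [← integral_avgCopy_mul hZ hX a hf hu i21,
      integral_fst_copyLaw hZ hX a (f := fun p => f p * u p) (hf.mul hu)]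
    rw [← integral_sub (by exact hF.integrable_mul hU) (integrable_avgCopy_mul hZ hX a hf hu i21)]
    refine integral_congr_ae ?_
    filter_upwards [grad_ae_eq hZ hX hindep a hf (hF.integrable one_le_two)] with ω hω
    rw [hω]
    simp only [functional, Pi.sub_apply]
    ring
  have hR : ∫ q, diffOp f a q.1 q.2 * diffOp u a q.1 q.2 ∂(copyLaw μ Z X a)
      = (∫ q, f q.1 * u q.1 ∂(copyLaw μ Z X a))
        - (∫ q, f q.1 * u (swapCopy a q).1 ∂(copyLaw μ Z X a))
        - (∫ q, f (swapCopy a q).1 * u q.1 ∂(copyLaw μ Z X a))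
        + ∫ q, f (swapCopy a q).1 * u (swapCopy a q).1 ∂(copyLaw μ Z X a) := by
    rw [← integral_sub (by exact i11) (by exact i12),
      ← integral_sub (by exact i11.sub i12) (by exact i21),
      ← integral_add (by exact (i11.sub i12).sub i21) (by exact i22)]
    refine integral_congr_ae (ae_of_all _ fun q => ?_)
    simp only [diffOp, swapCopy]
    ring
  rw [hL, hR, e22, e12]
  ring

lemma avgCopy_swapCopy (a : A) (f : E₀ × (∀ a, E a) → ℝ) (q : (E₀ × ∀ a, E a) × E a) :
    avgCopy μ Z X a f (swapCopy a q).1 = avgCopy μ Z X a f q.1 := by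
  simp [avgCopy, swapCopy]

/-- Averaging over the copy is a projection whose range is killed by `Δᵃ`, so
`E[(Dₐ F)²] = E[Dₐ F · F]`. -/
lemma integral_grad_sq [Countable A] (hZ : Measurable Z) (hX : ∀ a, Measurable (X a))
    (hindep : iCondIndepFun (sigmaZ Z) hZ.comap_le X μ) (a : A)
    {f : E₀ × (∀ a, E a) → ℝ} (hf : Measurable f) (hF : MemLp (functional Z X f) 2 μ) :
    ∫ ω, grad μ Z X a (functional Z X f) ω ^ 2 ∂μ
      = (1 / 2) * ∫ q, diffOp f a q.1 q.2 ^ 2 ∂(copyLaw μ Z X a) := by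
  have hE := condExp_sigmaWithout_eq_avgCopy hZ hX hindep a hf (hF.integrable one_le_two)
  have hA : MemLp (functional Z X (avgCopy μ Z X a f)) 2 μ :=
    (memLp_congr_ae hE).1 (hF.condExp one_le_two)
  have h1 := integral_grad_mul hZ hX hindep a hf hf hF hF
  have h2 := integral_grad_mul hZ hX hindep a hf (measurable_avgCopy a hf) hF hA
  have h3 : ∀ q : (E₀ × ∀ a, E a) × E a, diffOp (avgCopy μ Z X a f) a q.1 q.2 = 0 := fun q =>
    sub_eq_zero.2 (avgCopy_swapCopy a f q).symm
  simp only [h3, mul_zero, integral_zero] at h2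
  have h4 : ∫ ω, grad μ Z X a (functional Z X f) ω ^ 2 ∂μ
      = (∫ ω, grad μ Z X a (functional Z X f) ω * functional Z X f ω ∂μ)
        - ∫ ω, grad μ Z X a (functional Z X f) ω
            * functional Z X (avgCopy μ Z X a f) ω ∂μ := by
    rw [← integral_sub (by exact (memLp_grad hF).integrable_mul hF)
      (by exact (memLp_grad hF).integrable_mul hA)]
    refine integral_congr_ae ?_
    filter_upwards [grad_ae_eq hZ hX hindep a hf (hF.integrable one_le_two)] with ω hω
    rw [hω]
    simp only [Pi.sub_apply]
    ring
  rw [h4, h1, h2, sub_zero]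
  simp only [sq]

lemma integrable_diffOp_mul [Countable A] (hZ : Measurable Z) (hX : ∀ a, Measurable (X a))
    (hindep : iCondIndepFun (sigmaZ Z) hZ.comap_le X μ) (a : A)
    {f g : E₀ × (∀ a, E a) → ℝ} (hf : Measurable f) (hg : Measurable g)
    (hF : MemLp (functional Z X f) 2 μ) (hG : MemLp (functional Z X g) 2 μ) :
    Integrable (fun q => diffOp f a q.1 q.2 * diffOp g a q.1 q.2) (copyLaw μ Z X a) :=
  ((memLp_fst_copyLaw hZ hX a hf hF).sub
    (memLp_swapCopy_copyLaw hZ hX hindep a hf hF)).integrable_mul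
    ((memLp_fst_copyLaw hZ hX a hg hG).sub (memLp_swapCopy_copyLaw hZ hX hindep a hg hG))

/-- The `a`-th term of the series defining the carré du champ `Γ(F, G)`. -/
def carreTerm (μ : Measure Ω) (Z : Ω → E₀) (X : ∀ a, Ω → E a) (a : A) (F G : Ω → ℝ) : Ω → ℝ :=
  fun ω => (1 / 2 : ℝ) * (F ω * grad μ Z X a G ω + G ω * grad μ Z X a F ω
    - grad μ Z X a (F * G) ω)

/-- The `a`-th term of the carré du champ is `½ E[Δᵃ F Δᵃ G | Z, X]`, here with the square
expanded. -/
lemma carreTerm_ae_eq [Countable A] (hZ : Measurable Z) (hX : ∀ a, Measurable (X a))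
    (hindep : iCondIndepFun (sigmaZ Z) hZ.comap_le X μ) (a : A)
    {f g : E₀ × (∀ a, E a) → ℝ} (hf : Measurable f) (hg : Measurable g)
    (hF : MemLp (functional Z X f) 2 μ) (hG : MemLp (functional Z X g) 2 μ) :
    carreTerm μ Z X a (functional Z X f) (functional Z X g) =ᵐ[μ]
      functional Z X fun p => (1 / 2 : ℝ) * (f p * g p - avgCopy μ Z X a g p * f p
        - avgCopy μ Z X a f p * g p + avgCopy μ Z X a (fun p => f p * g p) p) := by
  filter_upwards [grad_ae_eq hZ hX hindep a hf (hF.integrable one_le_two),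
    grad_ae_eq hZ hX hindep a hg (hG.integrable one_le_two),
    grad_ae_eq hZ hX hindep a (f := fun p => f p * g p) (hf.mul hg)
      (by exact hF.integrable_mul hG)] with ω h1 h2 h3
  have h4 : functional Z X f * functional Z X g = functional Z X (fun p => f p * g p) := rfl
  simp only [carreTerm]
  rw [h4, h1, h2, h3]
  simp only [functional, Pi.sub_apply]
  ring

lemma integrable_carreTerm {a : A} {F G : Ω → ℝ} (hF : MemLp F 2 μ) (hG : MemLp G 2 μ) :
    Integrable (carreTerm μ Z X a F G) μ := by
  refine (((hF.integrable_mul (memLp_grad hG)).add (hG.integrable_mul (memLp_grad hF))).sub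
    ((hF.integrable_mul hG).sub integrable_condExp)).const_mul (1 / 2 : ℝ)

/-- `E[Γₐ(F, G) U] = ½ E[Δᵃ F Δᵃ G U]` for bounded `U`. -/
lemma integral_carreTerm_mul [Countable A] (hZ : Measurable Z) (hX : ∀ a, Measurable (X a))
    (hindep : iCondIndepFun (sigmaZ Z) hZ.comap_le X μ) (a : A)
    {f g u : E₀ × (∀ a, E a) → ℝ} (hf : Measurable f) (hg : Measurable g) (hu : Measurable u)
    (hF : MemLp (functional Z X f) 2 μ) (hG : MemLp (functional Z X g) 2 μ)
    {C : ℝ} (hC : ∀ p, ‖u p‖ ≤ C) :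
    ∫ ω, carreTerm μ Z X a (functional Z X f) (functional Z X g) ω * functional Z X u ω ∂μ
      = (1 / 2) * ∫ q, diffOp f a q.1 q.2 * diffOp g a q.1 q.2 * u q.1 ∂(copyLaw μ Z X a) := by
  have f1 := memLp_fst_copyLaw hZ hX a hf hF
  have g1 := memLp_fst_copyLaw hZ hX a hg hG
  have f2 := memLp_swapCopy_copyLaw hZ hX hindep a hf hF
  have g2 := memLp_swapCopy_copyLaw hZ hX hindep a hg hG
  have hb : ∀ {k : (E₀ × ∀ a, E a) × E a → ℝ}, Integrable k (copyLaw μ Z X a) →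
      Integrable (fun q => k q * u q.1) (copyLaw μ Z X a) := fun hk =>
    hk.mul_bdd (hu.comp measurable_fst).aestronglyMeasurable (ae_of_all _ fun q => hC q.1)
  have i11 := hb (f1.integrable_mul g1)
  have i21 := hb (f2.integrable_mul g1)
  have i12 := hb (f1.integrable_mul g2)
  have i22 := hb (f2.integrable_mul g2)
  have j12 : Integrable (fun q => g (swapCopy a q).1 * (f q.1 * u q.1)) (copyLaw μ Z X a) :=
    i12.congr (ae_of_all _ fun q => by simp only [Pi.mul_apply]; ring)
  have j21 : Integrable (fun q => f (swapCopy a q).1 * (g q.1 * u q.1)) (copyLaw μ Z X a) :=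
    i21.congr (ae_of_all _ fun q => by simp only [Pi.mul_apply]; ring)
  have k12 := integrable_avgCopy_mul hZ hX a hg (hf.mul hu) j12
  have k21 := integrable_avgCopy_mul hZ hX a hf (hg.mul hu) j21
  have k22 := integrable_avgCopy_mul hZ hX a (f := fun p => f p * g p) (hf.mul hg) hu
    (by exact i22)
  have k11 : Integrable (functional Z X fun p => f p * g p * u p) μ :=
    (hF.integrable_mul hG).mul_bdd (measurable_functional hZ hX hu).aestronglyMeasurable
      (ae_of_all _ fun ω => hC _)
  have hL : ∫ ω, carreTerm μ Z X a (functional Z X f) (functional Z X g) ω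
        * functional Z X u ω ∂μ
      = (1 / 2) * ((∫ q, f q.1 * g q.1 * u q.1 ∂(copyLaw μ Z X a))
        - (∫ q, g (swapCopy a q).1 * (f q.1 * u q.1) ∂(copyLaw μ Z X a))
        - (∫ q, f (swapCopy a q).1 * (g q.1 * u q.1) ∂(copyLaw μ Z X a))
        + ∫ q, f (swapCopy a q).1 * g (swapCopy a q).1 * u q.1 ∂(copyLaw μ Z X a)) := by
    rw [← integral_avgCopy_mul hZ hX a hg (w := fun p => f p * u p) (hf.mul hu) j12,
      ← integral_avgCopy_mul hZ hX a hf (w := fun p => g p * u p) (hg.mul hu) j21,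
      ← integral_avgCopy_mul hZ hX a (f := fun p => f p * g p) (hf.mul hg) hu (by exact i22),
      integral_fst_copyLaw hZ hX a (f := fun p => f p * g p * u p) ((hf.mul hg).mul hu),
      ← integral_sub k11 (by exact k12), ← integral_sub (by exact k11.sub k12) (by exact k21),
      ← integral_add (by exact (k11.sub k12).sub k21) (by exact k22), ← integral_const_mul]
    refine integral_congr_ae ?_
    filter_upwards [carreTerm_ae_eq hZ hX hindep a hf hg hF hG] with ω hω
    rw [hω]
    simp only [functional]
    ring
  rw [hL, ← integral_sub (by exact i11) (by exact j12),
      ← integral_sub (by exact i11.sub j12) (by exact j21),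
      ← integral_add (by exact (i11.sub j12).sub j21) (by exact i22)]
  congr 1
  refine integral_congr_ae (ae_of_all _ fun q => ?_)
  simp only [diffOp, swapCopy]
  ring

/-- `E|Γₐ(F, G)| ≤ ½ (E[(Dₐ F)²] + E[(Dₐ G)²])`, tested against the sign of `Γₐ(F, G)`. -/
lemma integral_abs_carreTerm_le [Countable A] (hZ : Measurable Z) (hX : ∀ a, Measurable (X a))
    (hindep : iCondIndepFun (sigmaZ Z) hZ.comap_le X μ) (a : A)
    {f g : E₀ × (∀ a, E a) → ℝ} (hf : Measurable f) (hg : Measurable g)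
    (hF : MemLp (functional Z X f) 2 μ) (hG : MemLp (functional Z X g) 2 μ) :
    ∫ ω, |carreTerm μ Z X a (functional Z X f) (functional Z X g) ω| ∂μ
      ≤ (1 / 2) * ((∫ ω, grad μ Z X a (functional Z X f) ω ^ 2 ∂μ)
        + ∫ ω, grad μ Z X a (functional Z X g) ω ^ 2 ∂μ) := by
  set w : E₀ × (∀ a, E a) → ℝ := fun p => (1 / 2 : ℝ) * (f p * g p - avgCopy μ Z X a g p * f p
        - avgCopy μ Z X a f p * g p + avgCopy μ Z X a (fun p => f p * g p) p) with hw_def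
  have hw : Measurable w := by
    have h1 := measurable_avgCopy (μ := μ) (Z := Z) (X := X) a hf
    have h2 := measurable_avgCopy (μ := μ) (Z := Z) (X := X) a hg
    have h3 := measurable_avgCopy (μ := μ) (Z := Z) (X := X) a
      (f := fun p => f p * g p) (hf.mul hg)
    fun_prop
  classical
  let u : E₀ × (∀ a, E a) → ℝ := fun p => if 0 ≤ w p then 1 else -1
  have hu : Measurable u :=
    Measurable.ite (measurableSet_le measurable_const hw) measurable_const measurable_const
  have hub : ∀ p, ‖u p‖ ≤ 1 := fun p => by
    simp only [u]
    split_ifs <;> simp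
  have h1 : ∫ ω, |carreTerm μ Z X a (functional Z X f) (functional Z X g) ω| ∂μ
      = ∫ ω, carreTerm μ Z X a (functional Z X f) (functional Z X g) ω
        * functional Z X u ω ∂μ := by
    refine integral_congr_ae ?_
    filter_upwards [carreTerm_ae_eq hZ hX hindep a hf hg hF hG] with ω hω
    rw [hω]
    simp only [functional, u]
    split_ifs with h
    · rw [mul_one]
      exact abs_of_nonneg h
    · rw [mul_neg_one]
      exact abs_of_nonpos (not_le.1 h).le
  have iff := integrable_diffOp_mul hZ hX hindep a hf hf hF hF
  have igg := integrable_diffOp_mul hZ hX hindep a hg hg hG hG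
  have ifg := integrable_diffOp_mul hZ hX hindep a hf hg hF hG
  rw [h1, integral_carreTerm_mul hZ hX hindep a hf hg hu hF hG hub,
    integral_grad_sq hZ hX hindep a hf hF, integral_grad_sq hZ hX hindep a hg hG, ← mul_add,
    ← integral_add (by simpa only [sq] using iff) (by simpa only [sq] using igg)]
  have hrhs : (1 / 2 : ℝ) * (1 / 2 * ∫ q, diffOp f a q.1 q.2 ^ 2 + diffOp g a q.1 q.2 ^ 2
      ∂(copyLaw μ Z X a)) = 1 / 2 * ∫ q, 1 / 2 * (diffOp f a q.1 q.2 ^ 2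
        + diffOp g a q.1 q.2 ^ 2) ∂(copyLaw μ Z X a) := by
    rw [integral_const_mul]
  rw [hrhs]
  refine mul_le_mul_of_nonneg_left (integral_mono ?_ ?_ fun q => ?_) one_half_pos.le
  · exact ifg.mul_bdd (hu.comp measurable_fst).aestronglyMeasurable (ae_of_all _ fun q => hub q.1)
  · simpa only [sq, Pi.add_apply] using! (iff.add igg).const_mul (1 / 2)
  · have h := hub q.1
    have h2 : |diffOp f a q.1 q.2 * diffOp g a q.1 q.2 * u q.1|
        ≤ |diffOp f a q.1 q.2 * diffOp g a q.1 q.2| := by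
      rw [abs_mul]
      exact mul_le_of_le_one_right (abs_nonneg _) h
    refine (le_abs_self _).trans (h2.trans ?_)
    rw [abs_mul]
    nlinarith [sq_nonneg (|diffOp f a q.1 q.2| - |diffOp g a q.1 q.2|),
      sq_abs (diffOp f a q.1 q.2), sq_abs (diffOp g a q.1 q.2)]

end Gradient

/-! ### Series along the finite subsets -/

section Series

variable {Ω A : Type*} [mΩ : MeasurableSpace Ω] {μ : Measure Ω} [IsProbabilityMeasure μ]

lemma tendsto_integral_mul_of_tendsto_eLpNorm_two {ι : Type*} {l : Filter ι} {u : ι → Ω → ℝ}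
    {v w : Ω → ℝ} (hu : ∀ i, MemLp (u i) 2 μ) (hv : MemLp v 2 μ) (hw : MemLp w 2 μ)
    (h : Tendsto (fun i => eLpNorm (fun ω => u i ω - v ω) 2 μ) l (𝓝 0)) :
    Tendsto (fun i => ∫ ω, u i ω * w ω ∂μ) l (𝓝 (∫ ω, v ω * w ω ∂μ)) := by
  refine tendsto_integral_of_L1' (fun ω => v ω * w ω) (hv.integrable_mul hw).1
    (Eventually.of_forall fun i => (hu i).integrable_mul hw) ?_
  have hlim : Tendsto (fun i => eLpNorm (fun ω => u i ω - v ω) 2 μ * eLpNorm w 2 μ) l (𝓝 0) := by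
    have := ENNReal.Tendsto.mul_const (b := eLpNorm w 2 μ) h (Or.inr hw.eLpNorm_ne_top)
    rwa [zero_mul] at this
  refine tendsto_of_tendsto_of_tendsto_of_le_of_le tendsto_const_nhds hlim
    (fun _ => zero_le) fun i => ?_
  have := eLpNorm_smul_le_mul_eLpNorm (p := 2) (q := 2) (r := 1) hw.1
    ((hu i).sub hv).1
  convert! this using 2
  ext ω
  simp [sub_mul]

lemma tendsto_integral_mul_of_tendsto_eLpNorm_one {ι : Type*} {l : Filter ι} {u : ι → Ω → ℝ}
    {v w : Ω → ℝ} (hu : ∀ i, Integrable (u i) μ) (hv : Integrable v μ)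
    (hw : AEStronglyMeasurable w μ) {C : ℝ} (hC : ∀ ω, ‖w ω‖ ≤ C)
    (h : Tendsto (fun i => eLpNorm (fun ω => u i ω - v ω) 1 μ) l (𝓝 0)) :
    Tendsto (fun i => ∫ ω, u i ω * w ω ∂μ) l (𝓝 (∫ ω, v ω * w ω ∂μ)) := by
  refine tendsto_integral_of_L1' (fun ω => v ω * w ω) (hv.mul_bdd hw (ae_of_all _ hC)).1
    (Eventually.of_forall fun i => (hu i).mul_bdd hw (ae_of_all _ hC)) ?_
  have hlim : Tendsto (fun i => ENNReal.ofReal C * eLpNorm (fun ω => u i ω - v ω) 1 μ) l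
      (𝓝 0) := by
    have := ENNReal.Tendsto.const_mul (a := ENNReal.ofReal C) h (Or.inr ENNReal.ofReal_ne_top)
    rwa [mul_zero] at this
  refine tendsto_of_tendsto_of_tendsto_of_le_of_le tendsto_const_nhds hlim
    (fun _ => zero_le) fun i => ?_
  refine eLpNorm_le_mul_eLpNorm_of_ae_le_mul (ae_of_all _ fun ω => ?_) 1
  simp only [Pi.sub_apply]
  rw [← sub_mul, norm_mul, mul_comm]
  exact mul_le_mul_of_nonneg_right (hC ω) (norm_nonneg _)

variable {E₀ : Type*} {E : A → Type*} [MeasurableSpace E₀] [∀ a, MeasurableSpace (E a)]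
  {Z : Ω → E₀} {X : ∀ a, Ω → E a}

/-- `E[(L F) W] = - ∑ₐ E[Dₐ F · W]`. -/
lemma hasSum_integral_grad_mul {F H W : Ω → ℝ} (hFH : IsGenerator μ Z X F H) (hW : MemLp W 2 μ) :
    HasSum (fun a => ∫ ω, grad μ Z X a F ω * W ω ∂μ) (-∫ ω, H ω * W ω ∂μ) := by
  obtain ⟨hF, hH, hlim⟩ := hFH
  have hg : ∀ a, MemLp (grad μ Z X a F) 2 μ := fun a => hF.sub (hF.condExp one_le_two)
  have h := (tendsto_integral_mul_of_tendsto_eLpNorm_two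
    (u := fun (J : Finset A) ω => -∑ a ∈ J, grad μ Z X a F ω)
    (fun J => (memLp_finsetSum J fun a _ => hg a).neg) hH hW hlim).neg
  refine h.congr fun J => ?_
  rw [← integral_neg]
  refine Eq.trans ?_ (integral_finsetSum (f := fun a ω => grad μ Z X a F ω * W ω) J
    fun a _ => (hg a).integrable_mul hW)
  refine integral_congr_ae (ae_of_all _ fun ω => ?_)
  simp only [neg_mul, neg_neg, Finset.sum_mul]

lemma gradEnergy_eq_tsum {F : Ω → ℝ} (hF : MemLp F 2 μ) :
    gradEnergy μ Z X F = ∑' a, ENNReal.ofReal (∫ ω, grad μ Z X a F ω ^ 2 ∂μ) := by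
  unfold gradEnergy
  congr 1
  ext a
  have hg : MemLp (grad μ Z X a F) 2 μ := hF.sub (hF.condExp one_le_two)
  rw [ofReal_integral_eq_lintegral_ofReal hg.integrable_sq (ae_of_all _ fun ω => sq_nonneg _)]
  refine lintegral_congr fun ω => ?_
  rw [← enorm_pow, Real.enorm_eq_ofReal (sq_nonneg _)]

end Series

/-! ### The Ornstein–Uhlenbeck operator on square-integrable functionals -/

section CondProj

variable {Ω : Type*} {m mΩ : MeasurableSpace Ω} {μ : Measure Ω} [IsProbabilityMeasure μ]

/-- Conditional expectation given `m` as an operator on `L²`. -/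
def condProj (μ : Measure Ω) (hm : m ≤ mΩ) : Lp ℝ 2 μ →L[ℝ] Lp ℝ 2 μ :=
  (lpMeas ℝ ℝ m 2 μ).subtypeL.comp (condExpL2 ℝ ℝ hm)

lemma condProj_ae_eq (hm : m ≤ mΩ) (x : Lp ℝ 2 μ) : condProj μ hm x =ᵐ[μ] μ[x | m] := by
  have h := (Lp.memLp x).condExpL2_ae_eq_condExp (𝕜 := ℝ) hm
  rwa [Lp.toLp_coeFn] at h

lemma inner_condProj (hm : m ≤ mΩ) (x y : Lp ℝ 2 μ) :
    inner ℝ (condProj μ hm x) y = inner ℝ x (condProj μ hm y) :=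
  inner_condExpL2_left_eq_right hm

lemma norm_condProj_le (hm : m ≤ mΩ) (x : Lp ℝ 2 μ) : ‖condProj μ hm x‖ ≤ ‖x‖ :=
  norm_condExpL2_coe_le hm x

lemma condProj_mem (hm : m ≤ mΩ) (x : Lp ℝ 2 μ) : condProj μ hm x ∈ lpMeas ℝ ℝ m 2 μ :=
  (condExpL2 ℝ ℝ hm x).2

end CondProj

section OrnsteinUhlenbeck

variable {Ω A E₀ : Type*} {E : A → Type*} [mΩ : MeasurableSpace Ω] [MeasurableSpace E₀]
  [∀ a, MeasurableSpace (E a)] {Z : Ω → E₀} {X : ∀ a, Ω → E a}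

lemma sigmaWithout_le (hZ : Measurable Z) (hX : ∀ a, Measurable (X a)) (a : A) :
    sigmaWithout Z X a ≤ mΩ := by
  rw [sigmaWithout_eq_sigmaOn]
  exact sigmaOn_le hZ hX _

lemma sigmaOn_univ_eq_comap :
    sigmaOn Z X Set.univ
      = MeasurableSpace.comap (fun ω => (Z ω, fun a => X a ω)) inferInstance := by
  refine Eq.trans ?_ (MeasurableSpace.comap_prodMk Z (fun ω a => X a ω)).symm
  rw [MeasurableSpace.pi, MeasurableSpace.comap_iSup]
  simp only [MeasurableSpace.comap_comp, sigmaOn, iSup_univ]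
  rfl

variable {μ : Measure Ω} [IsProbabilityMeasure μ]

/-- The conditional expectations of `x` given `Z` and finitely many coordinates converge to `x` in
`L²`: they converge to some projection of `x`, which is identified along an exhausting sequence by
Lévy's upward theorem. -/
lemma tendsto_condProj_sigmaOn [Countable A] (hZ : Measurable Z) (hX : ∀ a, Measurable (X a))
    {x : Lp ℝ 2 μ} (hx : AEStronglyMeasurable[sigmaOn Z X Set.univ] x μ) :
    Tendsto (fun J : Finset A => condProj μ (sigmaOn_le hZ hX (J : Set A)) x) atTop (𝓝 x) := by
  let U : Finset A → Submodule ℝ (Lp ℝ 2 μ) := fun J => lpMeas ℝ ℝ (sigmaOn Z X (J : Set A)) 2 μ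
  have : ∀ J, (U J).HasOrthogonalProjection := fun J => by
    have : Fact (sigmaOn Z X (J : Set A) ≤ mΩ) := ⟨sigmaOn_le hZ hX _⟩
    exact inferInstanceAs (lpMeas ℝ ℝ (sigmaOn Z X (J : Set A)) 2 μ).HasOrthogonalProjection
  have hU : Monotone U := fun J K h y hy =>
    AEStronglyMeasurable.mono (sigmaOn_mono (Finset.coe_subset.2 h)) hy
  set y := (⨆ J, U J).topologicalClosure.starProjection x
  have h1 : Tendsto (fun J : Finset A => condProj μ (sigmaOn_le hZ hX (J : Set A)) x) atTop
      (𝓝 y) := Submodule.starProjection_tendsto_closure_iSup U hU x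
  suffices hxy : x = y by
    rw [← hxy] at h1
    exact h1
  obtain ⟨e, he⟩ := Countable.exists_injective_nat A
  let Jn : ℕ → Finset A := fun n => (Finset.range n).preimage e he.injOn
  have hJn : Tendsto Jn atTop atTop := by
    refine tendsto_atTop_finset_of_monotone (fun n k hnk a ha => ?_) fun a => ⟨e a + 1, ?_⟩
    · simp only [Jn, Finset.mem_preimage, Finset.mem_range] at ha ⊢
      omega
    · simp [Jn]
  have hmonoJ : Monotone Jn := fun n k hnk a ha => by
    simp only [Jn, Finset.mem_preimage, Finset.mem_range] at ha ⊢
    omega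
  let ℱ : Filtration ℕ mΩ :=
    { seq := fun n => sigmaOn Z X (Jn n : Set A)
      mono' := fun n k hnk => sigmaOn_mono (Finset.coe_subset.2 (hmonoJ hnk))
      le' := fun n => sigmaOn_le hZ hX _ }
  have hsup : ⨆ n, ℱ n = sigmaOn Z X Set.univ := by
    refine le_antisymm (iSup_le fun n => sigmaOn_mono (Set.subset_univ _)) ?_
    refine sup_le (le_sup_left.trans (le_iSup (fun n => ℱ n) 0)) (iSup₂_le fun a _ => ?_)
    refine le_trans ?_ (le_iSup (fun n => ℱ n) (e a + 1))
    exact (measurable_sigmaOn_right (S := (Jn (e a + 1) : Set A)) (by simp [Jn])).comap_le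
  have hae := tendsto_ae_condExp (μ := μ) (ℱ := ℱ) (x : Ω → ℝ)
  rw [hsup] at hae
  have hxe : μ[x | sigmaOn Z X Set.univ] =ᵐ[μ] x :=
    condExp_of_aestronglyMeasurable' (sigmaOn_le hZ hX _) hx ((Lp.memLp x).integrable one_le_two)
  have m1 : TendstoInMeasure μ (fun n => μ[x | ℱ n]) atTop x := by
    refine tendstoInMeasure_of_tendsto_ae (fun n => integrable_condExp.1) ?_
    filter_upwards [hae, hxe] with ω h2 h3
    rwa [h3] at h2
  have m2 : TendstoInMeasure μ (fun n => μ[x | ℱ n]) atTop y :=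
    (tendstoInMeasure_of_tendsto_Lp (h1.comp hJn)).congr_left fun n => condProj_ae_eq _ x
  exact Lp.ext (tendstoInMeasure_ae_unique m1 m2)

variable [StandardBorelSpace Ω] [∀ a, StandardBorelSpace (E a)] [∀ a, Nonempty (E a)]

open Classical in
lemma condProj_sigmaWithout_sigmaOn [Countable A] (hZ : Measurable Z) (hX : ∀ a, Measurable (X a))
    (hindep : iCondIndepFun (sigmaZ Z) hZ.comap_le X μ) (a : A) (J : Finset A) (x : Lp ℝ 2 μ) :
    condProj μ (sigmaWithout_le hZ hX a) (condProj μ (sigmaOn_le hZ hX (J : Set A)) x)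
      = condProj μ (sigmaOn_le hZ hX ((J.erase a : Finset A) : Set A)) x := by
  refine Lp.ext ?_
  have h1 := condProj_ae_eq (sigmaWithout_le hZ hX a)
    (condProj μ (sigmaOn_le hZ hX (J : Set A)) x)
  have h2 := condExp_congr_ae (m := sigmaWithout Z X a)
    (condProj_ae_eq (sigmaOn_le hZ hX (J : Set A)) x)
  have h3 := condExp_sigmaWithout_condExp_sigmaOn hZ hX hindep a (J : Set A) x
  have h4 := condProj_ae_eq (sigmaOn_le hZ hX ((J.erase a : Finset A) : Set A)) x
  rw [← Finset.coe_erase] at h3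
  exact (h1.trans (h2.trans h3)).trans h4.symm

open Classical in
lemma condProj_sigmaOn_sigmaWithout [Countable A] (hZ : Measurable Z) (hX : ∀ a, Measurable (X a))
    (hindep : iCondIndepFun (sigmaZ Z) hZ.comap_le X μ) (a : A) (J : Finset A) (x : Lp ℝ 2 μ) :
    condProj μ (sigmaOn_le hZ hX (J : Set A)) (condProj μ (sigmaWithout_le hZ hX a) x)
      = condProj μ (sigmaOn_le hZ hX ((J.erase a : Finset A) : Set A)) x := by
  refine ext_inner_right ℝ fun y => ?_
  rw [inner_condProj, inner_condProj, condProj_sigmaWithout_sigmaOn hZ hX hindep, inner_condProj]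

lemma aestronglyMeasurable_toLp_functional {f : E₀ × (∀ a, E a) → ℝ} (hf : Measurable f)
    (hF : MemLp (functional Z X f) 2 μ) :
    AEStronglyMeasurable[sigmaOn Z X Set.univ] (hF.toLp _) μ := by
  have h : Measurable[sigmaOn Z X Set.univ] (functional Z X f) := by
    rw [sigmaOn_univ_eq_comap]
    exact hf.comp (comap_measurable _)
  exact h.stronglyMeasurable.aestronglyMeasurable.congr hF.coeFn_toLp.symm

lemma condProj_empty_toLp_eq_zero (hZ : Measurable Z) (hX : ∀ a, Measurable (X a)) {F : Ω → ℝ}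
    (hF : MemLp F 2 μ) (hcent : μ[F | sigmaZ Z] =ᵐ[μ] 0) :
    condProj μ (sigmaOn_le hZ hX ((∅ : Finset A) : Set A)) (hF.toLp F) = 0 := by
  refine Lp.ext ?_
  have h1 := condProj_ae_eq (sigmaOn_le hZ hX ((∅ : Finset A) : Set A)) (hF.toLp F)
  have h2 := condExp_congr_ae (m := sigmaOn Z X ((∅ : Finset A) : Set A)) hF.coeFn_toLp
  have h3 : μ[F | sigmaOn Z X ((∅ : Finset A) : Set A)] =ᵐ[μ] 0 := by
    rw [Finset.coe_empty, sigmaOn_empty]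
    exact hcent
  exact (h1.trans (h2.trans h3)).trans (Lp.coeFn_zero _ _ _).symm

lemma sub_condProj_ae_eq_grad (hZ : Measurable Z) (hX : ∀ a, Measurable (X a)) (a : A)
    (x : Lp ℝ 2 μ) :
    (x - condProj μ (sigmaWithout_le hZ hX a) x : Lp ℝ 2 μ) =ᵐ[μ] grad μ Z X a x :=
  (Lp.coeFn_sub _ _).trans
    ((EventuallyEq.refl _ _).sub (condProj_ae_eq (sigmaWithout_le hZ hX a) x))

lemma grad_congr_ae {a : A} {F G : Ω → ℝ} (h : F =ᵐ[μ] G) :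
    grad μ Z X a F =ᵐ[μ] grad μ Z X a G :=
  h.sub (condExp_congr_ae h)

/-- The **Efron–Stein inequality** for functionals with `E[F | Z] = 0`. -/
lemma ofReal_integral_sq_le_gradEnergy [Countable A] (hZ : Measurable Z)
    (hX : ∀ a, Measurable (X a)) (hindep : iCondIndepFun (sigmaZ Z) hZ.comap_le X μ)
    {f : E₀ × (∀ a, E a) → ℝ} (hf : Measurable f) (hF : MemLp (functional Z X f) 2 μ)
    (hcent : μ[functional Z X f | sigmaZ Z] =ᵐ[μ] 0) :
    ENNReal.ofReal (∫ ω, functional Z X f ω ^ 2 ∂μ) ≤ gradEnergy μ Z X (functional Z X f) := by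
  classical
  set F := functional Z X f
  set x := hF.toLp F with hx
  have hnorm : ∀ z : Lp ℝ 2 μ, ‖z‖ ^ 2 = ∫ ω, z ω ^ 2 ∂μ := fun z => by
    rw [← real_inner_self_eq_norm_sq, L2.inner_def]
    simp [sq]
  have hlim := tendsto_condProj_sigmaOn hZ hX (aestronglyMeasurable_toLp_functional hf hF)
  have hJ : ∀ J : Finset A,
      ENNReal.ofReal (‖condProj μ (sigmaOn_le hZ hX (J : Set A)) x‖ ^ 2)
        ≤ gradEnergy μ Z X F := by
    intro J
    have h := norm_sq_le_add_sum_norm_sub_sq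
      (p := fun a => condProj μ (sigmaWithout_le hZ hX a))
      (Q := fun J : Finset A => condProj μ (sigmaOn_le hZ hX (J : Set A)))
      (fun a => inner_condProj _) (condProj_sigmaWithout_sigmaOn hZ hX hindep)
      (condProj_sigmaOn_sigmaWithout hZ hX hindep) (fun J => norm_condProj_le _) x J
    simp only [hx, condProj_empty_toLp_eq_zero hZ hX hF hcent, norm_zero] at h
    rw [zero_pow two_ne_zero, zero_add] at h
    rw [gradEnergy_eq_tsum hF]
    refine (ENNReal.ofReal_le_ofReal h).trans ?_
    rw [ENNReal.ofReal_sum_of_nonneg fun _ _ => by positivity]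
    refine le_trans (le_of_eq (Finset.sum_congr rfl fun a _ => ?_)) (ENNReal.sum_le_tsum J)
    rw [hnorm]
    congr 1
    refine integral_congr_ae ?_
    filter_upwards [sub_condProj_ae_eq_grad hZ hX a (hF.toLp F),
      grad_congr_ae (Z := Z) (X := X) (a := a) hF.coeFn_toLp] with ω h1 h2
    rw [h1, h2]
  have hxF : ∫ ω, F ω ^ 2 ∂μ = ‖x‖ ^ 2 := by
    rw [hnorm]
    refine integral_congr_ae ?_
    filter_upwards [hF.coeFn_toLp] with ω hω
    rw [hω]
  rw [hxF]
  exact le_of_tendsto (ENNReal.tendsto_ofReal (hlim.norm.pow 2)) (Eventually.of_forall hJ)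

/-- Existence of `L⁻¹ F`. The solution found in `L²` is a limit of `σ(Z, X)`-measurable functions,
hence almost surely a function of `(Z, X)`. -/
lemma exists_isPseudoInverse [Countable A] (hZ : Measurable Z)
    (hX : ∀ a, Measurable (X a)) (hindep : iCondIndepFun (sigmaZ Z) hZ.comap_le X μ)
    {f : E₀ × (∀ a, E a) → ℝ} (hf : Measurable f) (hF : MemLp (functional Z X f) 2 μ)
    (hcent : μ[functional Z X f | sigmaZ Z] =ᵐ[μ] 0) :
    ∃ g, IsPseudoInverse μ Z X (functional Z X f) g := by
  classical
  set F := functional Z X f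
  set x := hF.toLp F with hx
  obtain ⟨G, hG0, hGlim, hGmem⟩ := exists_tendsto_neg_sum_sub
    (p := fun a => condProj μ (sigmaWithout_le hZ hX a))
    (Q := fun J : Finset A => condProj μ (sigmaOn_le hZ hX (J : Set A)))
    (fun a => inner_condProj _) (condProj_sigmaWithout_sigmaOn hZ hX hindep)
    (condProj_sigmaOn_sigmaWithout hZ hX hindep) (fun J => norm_condProj_le _) (x := x)
    (tendsto_condProj_sigmaOn hZ hX (aestronglyMeasurable_toLp_functional hf hF))
    (condProj_empty_toLp_eq_zero hZ hX hF hcent)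
  have hGm : AEStronglyMeasurable[sigmaOn Z X Set.univ] G μ := by
    refine hGmem (lpMeas ℝ ℝ (sigmaOn Z X Set.univ) 2 μ)
      (isClosed_aestronglyMeasurable (sigmaOn_le hZ hX _)) fun J => ?_
    exact AEStronglyMeasurable.mono (sigmaOn_mono (Set.subset_univ _))
      (condProj_mem (sigmaOn_le hZ hX (J : Set A)) x)
  obtain ⟨G', hG', hGG'⟩ := hGm
  obtain ⟨g, hg, hgG⟩ : ∃ g : E₀ × (∀ a, E a) → ℝ, StronglyMeasurable g ∧
      G' = g ∘ fun ω => (Z ω, fun a => X a ω) := by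
    refine StronglyMeasurable.exists_eq_measurable_comp ?_
    convert hG'
    exact sigmaOn_univ_eq_comap.symm
  have hgG' : G =ᵐ[μ] functional Z X g := by
    refine hGG'.trans ?_
    rw [hgG]
    rfl
  refine ⟨g, hg.measurable, ?_, (memLp_congr_ae hgG').1 (Lp.memLp G), hF, ?_⟩
  · have h1 := condProj_ae_eq (sigmaOn_le hZ hX ((∅ : Finset A) : Set A)) G
    rw [hG0] at h1
    have h2 : μ[G | sigmaOn Z X ((∅ : Finset A) : Set A)] =ᵐ[μ] μ[functional Z X g | sigmaZ Z] := by
      rw [Finset.coe_empty, sigmaOn_empty]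
      exact condExp_congr_ae hgG'
    exact h2.symm.trans (h1.symm.trans (Lp.coeFn_zero _ _ _))
  · rw [Lp.tendsto_Lp_iff_tendsto_eLpNorm'] at hGlim
    refine hGlim.congr fun J => eLpNorm_congr_ae ?_
    have h1 : ∀ a ∈ J, (G - condProj μ (sigmaWithout_le hZ hX a) G : Lp ℝ 2 μ)
        =ᵐ[μ] grad μ Z X a (functional Z X g) := fun a _ =>
      (sub_condProj_ae_eq_grad hZ hX a G).trans (grad_congr_ae hgG')
    have h2 : ∀ᵐ ω ∂μ, ∀ a ∈ J, (G - condProj μ (sigmaWithout_le hZ hX a) G : Lp ℝ 2 μ) ω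
        = grad μ Z X a (functional Z X g) ω := (ae_ball_iff J.countable_toSet).2 h1
    filter_upwards [h2, hF.coeFn_toLp, Lp.coeFn_neg (∑ a ∈ J, (G - condProj μ
      (sigmaWithout_le hZ hX a) G : Lp ℝ 2 μ)), Lp.coeFn_finsetSum J
      (fun a => (G - condProj μ (sigmaWithout_le hZ hX a) G : Lp ℝ 2 μ))] with ω e1 e2 e3 e4
    simp only [Pi.sub_apply]
    rw [e2, e3, Pi.neg_apply, e4, Finset.sum_apply, Finset.sum_congr rfl e1]

end OrnsteinUhlenbeck

/-! ### Energies and existence of the carré du champ -/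

section Bounds

variable {Ω A E₀ : Type*} {E : A → Type*} [mΩ : MeasurableSpace Ω] [MeasurableSpace E₀]
  [∀ a, MeasurableSpace (E a)] {Z : Ω → E₀} {X : ∀ a, Ω → E a}
  [StandardBorelSpace Ω] [∀ a, StandardBorelSpace (E a)] [∀ a, Nonempty (E a)]
  {μ : Measure Ω} [IsProbabilityMeasure μ]

/-- `‖D F‖² = - E[F L F]` on the domain of `L`. -/
lemma hasSum_integral_grad_sq [Countable A] (hZ : Measurable Z)
    (hX : ∀ a, Measurable (X a)) (hindep : iCondIndepFun (sigmaZ Z) hZ.comap_le X μ)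
    {f : E₀ × (∀ a, E a) → ℝ} (hf : Measurable f) {H : Ω → ℝ}
    (hFH : IsGenerator μ Z X (functional Z X f) H) :
    HasSum (fun a => ∫ ω, grad μ Z X a (functional Z X f) ω ^ 2 ∂μ)
      (-∫ ω, functional Z X f ω * H ω ∂μ) := by
  have h := hasSum_integral_grad_mul hFH hFH.1
  simp only [integral_grad_mul hZ hX hindep _ hf hf hFH.1 hFH.1, ← sq,
    ← integral_grad_sq hZ hX hindep _ hf hFH.1] at h
  simpa only [mul_comm] using h

lemma gradEnergy_eq_ofReal [Countable A] (hZ : Measurable Z)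
    (hX : ∀ a, Measurable (X a)) (hindep : iCondIndepFun (sigmaZ Z) hZ.comap_le X μ)
    {f : E₀ × (∀ a, E a) → ℝ} (hf : Measurable f) {H : Ω → ℝ}
    (hFH : IsGenerator μ Z X (functional Z X f) H) :
    gradEnergy μ Z X (functional Z X f)
      = ENNReal.ofReal (-∫ ω, functional Z X f ω * H ω ∂μ) := by
  have h := hasSum_integral_grad_sq hZ hX hindep hf hFH
  rw [gradEnergy_eq_tsum hFH.1, ← h.tsum_eq, ENNReal.ofReal_tsum_of_nonneg
    (fun a => integral_nonneg fun ω => sq_nonneg _) h.summable]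

/-- The carré du champ series converges absolutely in `L¹` if both energies are finite. -/
lemma exists_isCarreDuChamp [Countable A] (hZ : Measurable Z)
    (hX : ∀ a, Measurable (X a)) (hindep : iCondIndepFun (sigmaZ Z) hZ.comap_le X μ)
    {f g : E₀ × (∀ a, E a) → ℝ} (hf : Measurable f) (hg : Measurable g)
    (hF : MemLp (functional Z X f) 2 μ) (hG : MemLp (functional Z X g) 2 μ)
    (hFe : gradEnergy μ Z X (functional Z X f) ≠ ∞)
    (hGe : gradEnergy μ Z X (functional Z X g) ≠ ∞) :
    ∃ γ, IsCarreDuChamp μ Z X (functional Z X f) (functional Z X g) γ := by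
  set F := functional Z X f
  set G := functional Z X g
  have hs : ∀ {K : Ω → ℝ}, MemLp K 2 μ → gradEnergy μ Z X K ≠ ∞ →
      Summable fun a => ∫ ω, grad μ Z X a K ω ^ 2 ∂μ := by
    intro K hK hKe
    rw [gradEnergy_eq_tsum hK] at hKe
    refine (ENNReal.summable_toReal hKe).congr fun a => ?_
    rw [ENNReal.toReal_ofReal (integral_nonneg fun ω => sq_nonneg _)]
  have hint : ∀ a, Integrable (carreTerm μ Z X a F G) μ := fun a => integrable_carreTerm hF hG
  have hsum : Summable fun a => (hint a).toL1 (carreTerm μ Z X a F G) := by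
    refine Summable.of_norm_bounded (((hs hF hFe).add (hs hG hGe)).mul_left (1 / 2)) fun a => ?_
    rw [L1.norm_of_fun_eq_integral_norm]
    exact integral_abs_carreTerm_le hZ hX hindep a hf hg hF hG
  obtain ⟨V, hV⟩ := hsum
  have hV' : Tendsto (fun J : Finset A => ∑ a ∈ J, (hint a).toL1 (carreTerm μ Z X a F G)) atTop
      (𝓝 V) := hV
  refine ⟨V, L1.integrable_coeFn V, ?_⟩
  rw [Lp.tendsto_Lp_iff_tendsto_eLpNorm'] at hV'
  refine hV'.congr fun J => eLpNorm_congr_ae ?_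
  have h2 : ∀ᵐ ω ∂μ, ∀ a ∈ J, (hint a).toL1 (carreTerm μ Z X a F G) ω
      = carreTerm μ Z X a F G ω :=
    (ae_ball_iff J.countable_toSet).2 fun a _ => (hint a).coeFn_toL1
  filter_upwards [h2, Lp.coeFn_finsetSum J
    (fun a => (hint a).toL1 (carreTerm μ Z X a F G))] with ω e1 e2
  simp only [Pi.sub_apply]
  rw [e2, Finset.sum_apply, Finset.sum_congr rfl e1]
  rfl

lemma hasSum_integral_carreTerm_mul {F G γ W : Ω → ℝ} (hF : MemLp F 2 μ) (hG : MemLp G 2 μ)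
    (hγ : IsCarreDuChamp μ Z X F G γ) (hW : AEStronglyMeasurable W μ) {C : ℝ}
    (hC : ∀ ω, ‖W ω‖ ≤ C) :
    HasSum (fun a => ∫ ω, carreTerm μ Z X a F G ω * W ω ∂μ) (∫ ω, γ ω * W ω ∂μ) := by
  have hint : ∀ a, Integrable (carreTerm μ Z X a F G) μ := fun a => integrable_carreTerm hF hG
  have h := tendsto_integral_mul_of_tendsto_eLpNorm_one
    (u := fun (J : Finset A) ω => ∑ a ∈ J, carreTerm μ Z X a F G ω)
    (fun J => integrable_finsetSum J fun a _ => hint a) hγ.1 hW hC hγ.2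
  refine h.congr fun J => ?_
  refine Eq.trans ?_ (integral_finsetSum (f := fun a ω => carreTerm μ Z X a F G ω * W ω) J
    fun a _ => (hint a).mul_bdd hW (ae_of_all _ hC))
  simp only [Finset.sum_mul]

lemma isCarreDuChamp_neg {F G γ : Ω → ℝ} (hγ : IsCarreDuChamp μ Z X F G γ) :
    IsCarreDuChamp μ Z X F (-G) (-γ) := by
  refine ⟨hγ.1.neg, hγ.2.congr fun J => ?_⟩
  rw [← eLpNorm_neg]
  refine eLpNorm_congr_ae ?_
  have h1 : ∀ K : Ω → ℝ, ∀ a, grad μ Z X a (-K) =ᵐ[μ] -grad μ Z X a K := by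
    intro K a
    filter_upwards [condExp_neg (μ := μ) K (sigmaWithout Z X a)] with ω hω
    simp only [grad, Pi.sub_apply, Pi.neg_apply, hω]
    ring
  have h2 : ∀ᵐ ω ∂μ, ∀ a ∈ J, grad μ Z X a (-G) ω = -grad μ Z X a G ω
      ∧ grad μ Z X a (F * -G) ω = -grad μ Z X a (F * G) ω := by
    refine (ae_ball_iff J.countable_toSet).2 fun a _ => ?_
    have h3 := h1 (F * G) a
    rw [← mul_neg] at h3
    filter_upwards [h1 G a, h3] with ω e1 e2
    exact ⟨e1, e2⟩
  filter_upwards [h2] with ω hω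
  have h3 : ∑ a ∈ J, (1 / 2 : ℝ) * (F ω * grad μ Z X a (-G) ω + (-G) ω * grad μ Z X a F ω
      - grad μ Z X a (F * -G) ω)
      = -∑ a ∈ J, (1 / 2 : ℝ) * (F ω * grad μ Z X a G ω + G ω * grad μ Z X a F ω
        - grad μ Z X a (F * G) ω) := by
    rw [← Finset.sum_neg_distrib]
    refine Finset.sum_congr rfl fun a ha => ?_
    rw [(hω a ha).1, (hω a ha).2, Pi.neg_apply]
    ring
  rw [h3]
  simp only [Pi.neg_apply]
  ring

lemma expectCopy_eq_lintegral_copyLaw (hZ : Measurable Z) (hX : ∀ a, Measurable (X a)) (a : A)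
    {K : (E₀ × ∀ a, E a) → E a → ℝ≥0∞}
    (hK : Measurable fun q : (E₀ × ∀ a, E a) × E a => K q.1 q.2) :
    expectCopy μ Z X a K = ∫⁻ q, K q.1 q.2 ∂(copyLaw μ Z X a) :=
  (lintegral_copyLaw hZ hX a hK).symm

lemma measurable_diffOp (a : A) {f : E₀ × (∀ a, E a) → ℝ} (hf : Measurable f) :
    Measurable fun q : (E₀ × ∀ a, E a) × E a => diffOp f a q.1 q.2 :=
  (hf.comp measurable_fst).sub (measurable_comp_swapCopy a hf)

/-! ### The Malliavin–Stein bound -/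

/-- The error made in the chain rule: `- E[Dₐ G φ(F)]` differs from `E[Γₐ(F, -G) φ'(F)]` by a
Taylor remainder. -/
lemma enorm_neg_integral_grad_mul_sub_le [Countable A] (hZ : Measurable Z)
    (hX : ∀ a, Measurable (X a)) (hindep : iCondIndepFun (sigmaZ Z) hZ.comap_le X μ) (a : A)
    {f g : E₀ × (∀ a, E a) → ℝ} (hf : Measurable f) (hg : Measurable g)
    (hF : MemLp (functional Z X f) 2 μ) (hG : MemLp (functional Z X g) 2 μ)
    {φ φ' : ℝ → ℝ} (hφ : ∀ x, HasDerivAt φ (φ' x) x) (hL : LipschitzWith 2 φ')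
    {C C' : ℝ} (hC : ∀ x, |φ x| ≤ C) (hC' : ∀ x, |φ' x| ≤ C') :
    ‖-(∫ ω, grad μ Z X a (functional Z X g) ω * φ (functional Z X f ω) ∂μ)
        - ∫ ω, carreTerm μ Z X a (functional Z X f) (-functional Z X g) ω
            * φ' (functional Z X f ω) ∂μ‖ₑ
      ≤ (1 / 2) * expectCopy μ Z X a (fun p y => ‖diffOp g a p y‖ₑ * ‖diffOp f a p y‖ₑ ^ 2) := by
  have hφc : Continuous φ := continuous_iff_continuousAt.2 fun x => (hφ x).continuousAt
  have hφf : Measurable fun p => φ (f p) := hφc.measurable.comp hf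
  have hφf' : Measurable fun p => φ' (f p) := hL.continuous.measurable.comp hf
  have hU : MemLp (functional Z X fun p => φ (f p)) 2 μ :=
    MemLp.of_bound (measurable_functional hZ hX hφf).aestronglyMeasurable C
      (ae_of_all _ fun ω => hC _)
  have e1 := integral_grad_mul hZ hX hindep a hg hφf hG hU
  have e2 := integral_carreTerm_mul hZ hX hindep a (g := fun p => -g p) hf hg.neg hφf' hF
    hG.neg (fun p => hC' _)
  have i1 := integrable_diffOp_mul hZ hX hindep a hg hφf hG hU
  have i2 : Integrable (fun q => diffOp f a q.1 q.2 * diffOp (fun p => -g p) a q.1 q.2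
      * φ' (f q.1)) (copyLaw μ Z X a) :=
    (integrable_diffOp_mul hZ hX hindep a hf hg.neg hF hG.neg).mul_bdd
      (hφf'.comp measurable_fst).aestronglyMeasurable (ae_of_all _ fun q => hC' _)
  have hd1 := measurable_diffOp (E₀ := E₀) a hf
  have hd2 := measurable_diffOp (E₀ := E₀) a hg
  have h1 : -(∫ ω, grad μ Z X a (functional Z X g) ω * φ (functional Z X f ω) ∂μ)
        - ∫ ω, carreTerm μ Z X a (functional Z X f) (-functional Z X g) ω
            * φ' (functional Z X f ω) ∂μ
      = ∫ q, (1 / 2) * -(diffOp g a q.1 q.2 * (φ (f q.1) - φ (f (swapCopy a q).1)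
          - φ' (f q.1) * (f q.1 - f (swapCopy a q).1))) ∂(copyLaw μ Z X a) := by
    refine (congrArg₂ (fun s t => -s - t) e1 e2).trans ?_
    rw [← mul_neg, ← integral_neg, ← mul_sub, ← integral_sub (by exact i1.neg) i2,
      ← integral_const_mul]
    refine integral_congr_ae (ae_of_all _ fun q => ?_)
    simp only [diffOp, swapCopy]
    ring
  rw [h1, expectCopy_eq_lintegral_copyLaw hZ hX a (by fun_prop),
    ← lintegral_const_mul _ (by fun_prop)]
  refine (enorm_integral_le_lintegral_enorm _).trans (lintegral_mono fun q => ?_)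
  rw [enorm_mul, enorm_neg, enorm_mul]
  have h2 : ‖(1 / 2 : ℝ)‖ₑ = 1 / 2 := by
    rw [Real.enorm_eq_ofReal (by norm_num), ENNReal.ofReal_div_of_pos two_pos]
    simp
  rw [h2]
  gcongr
  rw [← enorm_pow, Real.enorm_eq_ofReal_abs, Real.enorm_eq_ofReal_abs]
  exact ENNReal.ofReal_le_ofReal ((abs_taylor_remainder_le hφ hL _ _).trans (le_abs_self _))

/-- The first bound: test Stein's equation against `F = L G`, where `G = L⁻¹F`, and sum the chain
rule errors. -/
lemma wassersteinDist_gaussianReal_le [Countable A] (hZ : Measurable Z)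
    (hX : ∀ a, Measurable (X a)) (hindep : iCondIndepFun (sigmaZ Z) hZ.comap_le X μ)
    {f g : E₀ × (∀ a, E a) → ℝ} (hf : Measurable f) (hg : Measurable g)
    (hGF : IsGenerator μ Z X (functional Z X g) (functional Z X f)) {γ : Ω → ℝ}
    (hγ : IsCarreDuChamp μ Z X (functional Z X f) (-functional Z X g) γ) :
    wassersteinDist (μ.map (functional Z X f)) (gaussianReal 0 1) ≤
      ENNReal.ofReal (√(2 / Real.pi)) * ∫⁻ ω, ‖γ ω - 1‖ₑ ∂μ
        + (1 / 2) * ∑' a, expectCopy μ Z X a (fun p y =>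
            ‖diffOp g a p y‖ₑ * ‖diffOp f a p y‖ₑ ^ 2) := by
  obtain ⟨hG, hF, hlim⟩ := id hGF
  have hFm := measurable_functional hZ hX hf
  set F := functional Z X f with hF_def
  set G := functional Z X g with hG_def
  have : IsProbabilityMeasure (μ.map F) := Measure.isProbabilityMeasure_map hFm.aemeasurable
  refine wassersteinDist_le_of_forall_hasDerivAt ?_ ?_ fun h h' hh hc hb => ?_
  · exact (integrable_map_measure aestronglyMeasurable_id hFm.aemeasurable).2
      (hF.integrable one_le_two)
  · exact (memLp_id_gaussianReal (μ := 0) (v := 1) 1).integrable le_rfl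
  obtain ⟨φ, φ', ⟨C, hC⟩, hφ, hst, hC', hL⟩ := exists_stein_solution hh hc hb
  have hφc : Continuous φ := continuous_iff_continuousAt.2 fun x => (hφ x).continuousAt
  have hcont : Continuous h := continuous_iff_continuousAt.2 fun x => (hh x).continuousAt
  have mφ : AEStronglyMeasurable (fun ω => φ (F ω)) μ :=
    (hφc.measurable.comp hFm).aestronglyMeasurable
  have mφ' : AEStronglyMeasurable (fun ω => φ' (F ω)) μ :=
    (hL.continuous.measurable.comp hFm).aestronglyMeasurable
  have s1 := hasSum_integral_grad_mul hGF (MemLp.of_bound mφ C (ae_of_all _ fun ω => hC _))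
  have s2 := hasSum_integral_carreTerm_mul hF hG.neg hγ mφ' fun ω => hC' (F ω)
  have s3 := s1.neg.sub s2
  rw [neg_neg] at s3
  have iFφ : Integrable (fun ω => F ω * φ (F ω)) μ :=
    (hF.integrable one_le_two).mul_bdd mφ (ae_of_all _ fun ω => hC _)
  have iγφ : Integrable (fun ω => γ ω * φ' (F ω)) μ :=
    hγ.1.mul_bdd mφ' (ae_of_all _ fun ω => hC' _)
  have iφ' : Integrable (fun ω => φ' (F ω)) μ :=
    (integrable_const (√(2 / Real.pi))).mono' mφ' (ae_of_all _ fun ω => hC' _)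
  have hbound : ‖(∫ ω, F ω * φ (F ω) ∂μ) - ∫ ω, γ ω * φ' (F ω) ∂μ‖ₑ
      ≤ (1 / 2) * ∑' a, expectCopy μ Z X a (fun p y =>
            ‖diffOp g a p y‖ₑ * ‖diffOp f a p y‖ₑ ^ 2) := by
    rw [← ENNReal.tsum_mul_left]
    have ht : Tendsto (fun J : Finset A => ‖∑ a ∈ J, (-(∫ ω, grad μ Z X a G ω * φ (F ω) ∂μ)
        - ∫ ω, carreTerm μ Z X a F (-G) ω * φ' (F ω) ∂μ)‖ₑ) atTop
        (𝓝 ‖(∫ ω, F ω * φ (F ω) ∂μ) - ∫ ω, γ ω * φ' (F ω) ∂μ‖ₑ) :=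
      (continuous_enorm.tendsto _).comp s3
    refine le_of_tendsto ht (Eventually.of_forall fun J => ?_)
    refine (enorm_sum_le _ _).trans (le_trans (Finset.sum_le_sum fun a _ => ?_)
      (ENNReal.sum_le_tsum J))
    exact enorm_neg_integral_grad_mul_sub_le hZ hX hindep a hf hg hF hG hφ hL hC hC'
  have hstein : (∫ x, h x ∂(μ.map F)) - ∫ x, h x ∂(gaussianReal 0 1)
      = (∫ ω, φ' (F ω) * (1 - γ ω) ∂μ)
        - ((∫ ω, F ω * φ (F ω) ∂μ) - ∫ ω, γ ω * φ' (F ω) ∂μ) := by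
    rw [integral_map hFm.aemeasurable hcont.aestronglyMeasurable]
    have e1 : ∫ ω, h (F ω) ∂μ = ∫ ω, (φ' (F ω) - F ω * φ (F ω)
        + ∫ x, h x ∂(gaussianReal 0 1)) ∂μ := by
      refine integral_congr_ae (ae_of_all _ fun ω => ?_)
      simp only [hst]
      ring
    have e2 : ∫ ω, φ' (F ω) * (1 - γ ω) ∂μ = ∫ ω, (φ' (F ω) - γ ω * φ' (F ω)) ∂μ := by
      refine integral_congr_ae (ae_of_all _ fun ω => ?_)
      simp only
      ring
    rw [e1, e2, integral_add (by exact iφ'.sub iFφ) (integrable_const _), integral_sub iφ' iFφ,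
      integral_sub iφ' iγφ]
    simp
  rw [hstein, ← Real.enorm_eq_ofReal_abs]
  refine enorm_sub_le.trans (add_le_add ?_ hbound)
  refine (enorm_integral_le_lintegral_enorm _).trans ?_
  rw [← lintegral_const_mul'' (f := fun ω => ‖γ ω - 1‖ₑ) _
    (by exact (hγ.1.1.sub aestronglyMeasurable_const).enorm)]
  refine lintegral_mono fun ω => ?_
  rw [enorm_mul, ← enorm_neg (1 - γ ω), neg_sub]
  gcongr
  rw [Real.enorm_eq_ofReal_abs]
  exact ENNReal.ofReal_le_ofReal (hC' _)

/-! ### The fourth moment bound -/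

lemma lintegral_le_sqrt_lintegral_sq {α : Type*} [MeasurableSpace α] {ν : Measure α}
    {u v : α → ℝ≥0∞} (hu : AEMeasurable u ν) (hv : AEMeasurable v ν) :
    ∫⁻ q, u q * v q ∂ν
      ≤ (∫⁻ q, u q ^ 2 ∂ν) ^ (1 / 2 : ℝ) * (∫⁻ q, v q ^ 2 ∂ν) ^ (1 / 2 : ℝ) := by
  simpa using ENNReal.lintegral_mul_le_Lp_mul_Lq ν Real.HolderConjugate.two_two hu hv

lemma tsum_mul_le_sqrt_tsum_sq {ι : Type*} (u v : ι → ℝ≥0∞) :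
    ∑' i, u i ^ (1 / 2 : ℝ) * v i ^ (1 / 2 : ℝ)
      ≤ (∑' i, u i) ^ (1 / 2 : ℝ) * (∑' i, v i) ^ (1 / 2 : ℝ) := by
  rw [ENNReal.tsum_eq_iSup_sum]
  refine iSup_le fun s => ?_
  have h := ENNReal.inner_le_Lp_mul_Lq s (fun i => u i ^ (1 / 2 : ℝ)) (fun i => v i ^ (1 / 2 : ℝ))
    Real.HolderConjugate.two_two
  simp only [← ENNReal.rpow_mul] at h
  norm_num at h
  have h' : ∑ i ∈ s, u i ^ (1 / 2 : ℝ) * v i ^ (1 / 2 : ℝ)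
      ≤ (∑ i ∈ s, u i) ^ (1 / 2 : ℝ) * (∑ i ∈ s, v i) ^ (1 / 2 : ℝ) := by simpa using h
  refine h'.trans ?_
  gcongr <;> exact ENNReal.sum_le_tsum s

lemma lintegral_enorm_diffOp_sq [Countable A] (hZ : Measurable Z)
    (hX : ∀ a, Measurable (X a)) (hindep : iCondIndepFun (sigmaZ Z) hZ.comap_le X μ) (a : A)
    {g : E₀ × (∀ a, E a) → ℝ} (hg : Measurable g) (hG : MemLp (functional Z X g) 2 μ) :
    ∫⁻ q, ‖diffOp g a q.1 q.2‖ₑ ^ 2 ∂(copyLaw μ Z X a)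
      = 2 * ENNReal.ofReal (∫ ω, grad μ Z X a (functional Z X g) ω ^ 2 ∂μ) := by
  have hi := integrable_diffOp_mul hZ hX hindep a hg hg hG hG
  simp only [← sq] at hi
  rw [integral_grad_sq hZ hX hindep a hg hG, ← ENNReal.ofReal_ofNat 2,
    ← ENNReal.ofReal_mul zero_le_two, ← mul_assoc, mul_one_div_cancel two_ne_zero, one_mul,
    ofReal_integral_eq_lintegral_ofReal hi (ae_of_all _ fun q => sq_nonneg _)]
  refine lintegral_congr fun q => ?_
  rw [← enorm_pow, Real.enorm_eq_ofReal (sq_nonneg _)]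

/-- Cauchy–Schwarz for the remainder term; the factor `√2 / 2` comes from
`E[(Δᵃ G)²] = 2 E[(Dₐ G)²]`. -/
lemma half_mul_tsum_expectCopy_le [Countable A] (hZ : Measurable Z)
    (hX : ∀ a, Measurable (X a)) (hindep : iCondIndepFun (sigmaZ Z) hZ.comap_le X μ)
    {f g : E₀ × (∀ a, E a) → ℝ} (hf : Measurable f) (hg : Measurable g)
    (hG : MemLp (functional Z X g) 2 μ) :
    (1 / 2) * ∑' a, expectCopy μ Z X a (fun p y => ‖diffOp g a p y‖ₑ * ‖diffOp f a p y‖ₑ ^ 2)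
      ≤ ENNReal.ofReal (√2 / 2) * gradEnergy μ Z X (functional Z X g) ^ (1 / 2 : ℝ)
        * (∑' a, expectCopy μ Z X a (fun p y => ‖diffOp f a p y‖ₑ ^ 4)) ^ (1 / 2 : ℝ) := by
  have h1 : ∀ a, expectCopy μ Z X a (fun p y => ‖diffOp g a p y‖ₑ * ‖diffOp f a p y‖ₑ ^ 2)
      ≤ (2 * ENNReal.ofReal (∫ ω, grad μ Z X a (functional Z X g) ω ^ 2 ∂μ)) ^ (1 / 2 : ℝ)
        * expectCopy μ Z X a (fun p y => ‖diffOp f a p y‖ₑ ^ 4) ^ (1 / 2 : ℝ) := by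
    intro a
    have hd1 := measurable_diffOp (E₀ := E₀) a hf
    have hd2 := measurable_diffOp (E₀ := E₀) a hg
    rw [expectCopy_eq_lintegral_copyLaw hZ hX a (by fun_prop),
      expectCopy_eq_lintegral_copyLaw hZ hX a (by fun_prop),
      ← lintegral_enorm_diffOp_sq hZ hX hindep a hg hG]
    have h := lintegral_le_sqrt_lintegral_sq (ν := copyLaw μ Z X a) hd2.enorm.aemeasurable
      (hd1.enorm.pow_const 2).aemeasurable
    simpa only [← pow_mul] using h
  have h2 : (1 / 2 : ℝ≥0∞) * 2 ^ (1 / 2 : ℝ) = ENNReal.ofReal (√2 / 2) := by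
    rw [ENNReal.ofReal_div_of_pos two_pos, Real.sqrt_eq_rpow,
      ← ENNReal.ofReal_rpow_of_nonneg zero_le_two (by norm_num), ENNReal.ofReal_ofNat, mul_comm,
      mul_one_div]
  calc (1 / 2) * ∑' a, expectCopy μ Z X a (fun p y => ‖diffOp g a p y‖ₑ * ‖diffOp f a p y‖ₑ ^ 2)
      ≤ (1 / 2) * ((∑' a, 2 * ENNReal.ofReal
          (∫ ω, grad μ Z X a (functional Z X g) ω ^ 2 ∂μ)) ^ (1 / 2 : ℝ)
        * (∑' a, expectCopy μ Z X a (fun p y => ‖diffOp f a p y‖ₑ ^ 4)) ^ (1 / 2 : ℝ)) := by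
        gcongr
        exact (ENNReal.tsum_le_tsum h1).trans (tsum_mul_le_sqrt_tsum_sq _ _)
    _ = _ := by
        rw [ENNReal.tsum_mul_left, ← gradEnergy_eq_tsum hG,
          ENNReal.mul_rpow_of_nonneg _ _ (by norm_num), ← h2]
        ring

/-- If `E[F²] = 1`, then `‖D L⁻¹F‖² ≤ 1`: with `G = L⁻¹F` and `e = ‖D G‖² = - E[G F]`, the
Efron–Stein inequality gives `E[G²] ≤ e`, hence `0 ≤ E[(G + F)²] ≤ 1 - e`. -/
lemma gradEnergy_le_one [Countable A] (hZ : Measurable Z)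
    (hX : ∀ a, Measurable (X a)) (hindep : iCondIndepFun (sigmaZ Z) hZ.comap_le X μ)
    {F : Ω → ℝ} {g : E₀ × (∀ a, E a) → ℝ} (hg : IsPseudoInverse μ Z X F g)
    (hvar : ∫ ω, F ω ^ 2 ∂μ = 1) :
    gradEnergy μ Z X (functional Z X g) ≤ 1 := by
  obtain ⟨hgm, hcent, hgen⟩ := hg
  have h1 := ofReal_integral_sq_le_gradEnergy hZ hX hindep hgm hgen.1 hcent
  have h0 : 0 ≤ -∫ ω, functional Z X g ω * F ω ∂μ :=
    (hasSum_integral_grad_sq hZ hX hindep hgm hgen).nonneg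
      fun a => integral_nonneg fun ω => sq_nonneg _
  rw [gradEnergy_eq_ofReal hZ hX hindep hgm hgen] at h1 ⊢
  rw [ENNReal.ofReal_le_ofReal_iff h0] at h1
  rw [ENNReal.ofReal_le_one]
  set G := functional Z X g
  have h2 : 0 ≤ ∫ ω, (G ω + F ω) ^ 2 ∂μ := integral_nonneg fun ω => sq_nonneg _
  have iGF : Integrable (fun ω => 2 * (G ω * F ω)) μ := (hgen.1.integrable_mul hgen.2.1).const_mul 2
  have h3 : ∫ ω, (G ω + F ω) ^ 2 ∂μ
      = (∫ ω, G ω ^ 2 ∂μ) + 2 * (∫ ω, G ω * F ω ∂μ) + ∫ ω, F ω ^ 2 ∂μ := by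
    rw [← integral_const_mul, ← integral_add hgen.1.integrable_sq iGF,
      ← integral_add (by exact hgen.1.integrable_sq.add iGF) hgen.2.1.integrable_sq]
    refine integral_congr_ae (ae_of_all _ fun ω => ?_)
    simp only
    ring
  linarith

/-- `E[Γ(F, G)] = -E[F L G]`. -/
lemma integral_carreDuChamp [Countable A] (hZ : Measurable Z)
    (hX : ∀ a, Measurable (X a)) (hindep : iCondIndepFun (sigmaZ Z) hZ.comap_le X μ)
    {f g : E₀ × (∀ a, E a) → ℝ} (hf : Measurable f) (hg : Measurable g) {H : Ω → ℝ}
    (hF : MemLp (functional Z X f) 2 μ) (hGH : IsGenerator μ Z X (functional Z X g) H)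
    {γ : Ω → ℝ} (hγ : IsCarreDuChamp μ Z X (functional Z X f) (functional Z X g) γ) :
    ∫ ω, γ ω ∂μ = -∫ ω, H ω * functional Z X f ω ∂μ := by
  have h1 := hasSum_integral_carreTerm_mul hF hGH.1 hγ (W := fun _ => 1)
    aestronglyMeasurable_const (C := 1) (by simp)
  have h2 := hasSum_integral_grad_mul hGH hF
  simp only [integral_grad_mul hZ hX hindep _ hg hf hGH.1 hF] at h2
  have h3 : ∀ a, ∫ ω, carreTerm μ Z X a (functional Z X f) (functional Z X g) ω * 1 ∂μ
      = (1 / 2) * ∫ q, diffOp g a q.1 q.2 * diffOp f a q.1 q.2 ∂(copyLaw μ Z X a) := by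
    intro a
    have h := integral_carreTerm_mul hZ hX hindep a hf hg (u := fun _ => 1) measurable_const hF
      hGH.1 (C := 1) (by simp)
    simp only [mul_one] at h ⊢
    simp only [functional, mul_one] at h
    refine h.trans ?_
    simp only [mul_comm]
  simp only [h3] at h1
  have := h1.unique h2
  simpa using this

lemma lintegral_enorm_sub_integral_le {γ : Ω → ℝ} (hγ : AEStronglyMeasurable γ μ) :
    ∫⁻ ω, ‖γ ω - ∫ ω, γ ω ∂μ‖ₑ ∂μ ≤ evariance γ μ ^ (1 / 2 : ℝ) := by
  have h := lintegral_le_sqrt_lintegral_sq (ν := μ)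
    (hγ.sub (aestronglyMeasurable_const (b := ∫ ω, γ ω ∂μ))).enorm
    (aemeasurable_const (b := (1 : ℝ≥0∞)))
  simpa [evariance] using h

/-- The fourth moment bound in terms of the energy `‖DF‖²`. The energy of `G = L⁻¹F` enters
through `‖DG‖² ≤ 1 = E[F²] ≤ ‖DF‖²`. -/
lemma wassersteinDist_gaussianReal_le_evariance_add [Countable A] (hZ : Measurable Z)
    (hX : ∀ a, Measurable (X a)) (hindep : iCondIndepFun (sigmaZ Z) hZ.comap_le X μ)
    {f g : E₀ × (∀ a, E a) → ℝ} (hf : Measurable f)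
    (hcent : μ[functional Z X f | sigmaZ Z] =ᵐ[μ] 0)
    (hvar : ∫ ω, functional Z X f ω ^ 2 ∂μ = 1)
    (hg : IsPseudoInverse μ Z X (functional Z X f) g) {γ : Ω → ℝ}
    (hγ : IsCarreDuChamp μ Z X (functional Z X f) (functional Z X g) γ) :
    wassersteinDist (μ.map (functional Z X f)) (gaussianReal 0 1) ≤
      ENNReal.ofReal (√(2 / Real.pi)) * evariance γ μ ^ (1 / 2 : ℝ)
        + ENNReal.ofReal (√2 / 2) * gradEnergy μ Z X (functional Z X f) ^ (1 / 2 : ℝ)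
          * (∑' a, expectCopy μ Z X a (fun p y => ‖diffOp f a p y‖ₑ ^ 4)) ^ (1 / 2 : ℝ) := by
  obtain ⟨hgm, hgcent, hgen⟩ := id hg
  have hmean : ∫ ω, γ ω ∂μ = -1 := by
    rw [integral_carreDuChamp hZ hX hindep hf hgm hgen.2.1 hgen hγ, ← hvar]
    simp only [sq]
  have henergy : gradEnergy μ Z X (functional Z X g) ≤ gradEnergy μ Z X (functional Z X f) := by
    refine (gradEnergy_le_one hZ hX hindep hg hvar).trans ?_
    simpa [hvar] using ofReal_integral_sq_le_gradEnergy hZ hX hindep hf hgen.2.1 hcent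
  refine (wassersteinDist_gaussianReal_le hZ hX hindep hf hgm hgen
    (isCarreDuChamp_neg hγ)).trans (add_le_add ?_ ?_)
  · gcongr
    refine le_trans (le_of_eq (lintegral_congr fun ω => ?_))
      (lintegral_enorm_sub_integral_le hγ.1.1)
    rw [hmean, ← enorm_neg, Pi.neg_apply]
    congr 1
    ring
  · refine (half_mul_tsum_expectCopy_le hZ hX hindep hf hgm hgen.1).trans ?_
    gcongr

end Bounds

end CondMalliavin

end

theorem mainTheorem7 {Ω A E₀ : Type*} {E : A → Type*} [Countable A]
    [MeasurableSpace Ω] [StandardBorelSpace Ω]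
    [MeasurableSpace E₀] [StandardBorelSpace E₀]
    [∀ a, MeasurableSpace (E a)] [∀ a, StandardBorelSpace (E a)] [∀ a, Nonempty (E a)]
    (μ : Measure Ω) [IsProbabilityMeasure μ]
    (Z : Ω → E₀) (hZ : Measurable Z)
    (X : ∀ a, Ω → E a) (hX : ∀ a, Measurable (X a))
    (hindep : iCondIndepFun (CondMalliavin.sigmaZ Z) hZ.comap_le X μ)
    (f : E₀ × (∀ a, E a) → ℝ) (hf : Measurable f)
    (F : Ω → ℝ) (hF : F = CondMalliavin.functional Z X f)
    (hF3 : MemLp F 3 μ)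
    (hcent : μ[F | CondMalliavin.sigmaZ Z] =ᵐ[μ] 0)
    (hvar : ∫ ω, F ω ^ 2 ∂μ = 1) :
    (∃ g, CondMalliavin.IsPseudoInverse μ Z X F g) ∧
    ∀ (g : E₀ × (∀ a, E a) → ℝ) (G : Ω → ℝ), CondMalliavin.IsPseudoInverse μ Z X F g →
      G = CondMalliavin.functional Z X g →
      (CondMalliavin.gradEnergy μ Z X F < ∞ →
        ∃ γ, CondMalliavin.IsCarreDuChamp μ Z X F G γ) ∧
      (∀ γ, CondMalliavin.IsCarreDuChamp μ Z X F (-G) γ →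
        CondMalliavin.wassersteinDist (μ.map F) (gaussianReal 0 1) ≤
          ENNReal.ofReal (Real.sqrt (2 / Real.pi)) * ∫⁻ ω, ‖γ ω - 1‖ₑ ∂μ
          + (1 / 2) * ∑' a, CondMalliavin.expectCopy μ Z X a (fun p y =>
              ‖CondMalliavin.diffOp g a p y‖ₑ * ‖CondMalliavin.diffOp f a p y‖ₑ ^ 2)) ∧
      (MemLp F 4 μ → ∀ γ, CondMalliavin.IsCarreDuChamp μ Z X F G γ →
        (∀ H, CondMalliavin.IsGenerator μ Z X F H →
          CondMalliavin.wassersteinDist (μ.map F) (gaussianReal 0 1) ≤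
            ENNReal.ofReal (Real.sqrt (2 / Real.pi)) * evariance γ μ ^ (1 / 2 : ℝ)
            + ENNReal.ofReal (Real.sqrt 2 / 2)
              * ENNReal.ofReal (Real.sqrt (-∫ ω, F ω * H ω ∂μ))
              * (∑' a, CondMalliavin.expectCopy μ Z X a (fun p y =>
                  ‖CondMalliavin.diffOp f a p y‖ₑ ^ 4)) ^ (1 / 2 : ℝ)) ∧
        CondMalliavin.wassersteinDist (μ.map F) (gaussianReal 0 1) ≤
          ENNReal.ofReal (Real.sqrt (2 / Real.pi)) * evariance γ μ ^ (1 / 2 : ℝ)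
          + ENNReal.ofReal (Real.sqrt 2 / 2)
            * CondMalliavin.gradEnergy μ Z X F ^ (1 / 2 : ℝ)
            * (∑' a, CondMalliavin.expectCopy μ Z X a (fun p y =>
                ‖CondMalliavin.diffOp f a p y‖ₑ ^ 4)) ^ (1 / 2 : ℝ)) := by
  subst hF
  have hF2 : MemLp (CondMalliavin.functional Z X f) 2 μ := hF3.mono_exponent (by norm_num)
  refine ⟨CondMalliavin.exists_isPseudoInverse hZ hX hindep hf hF2 hcent, ?_⟩
  rintro g _ hg rfl
  obtain ⟨hgm, -, hgen⟩ := id hg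
  refine ⟨fun hFe => ?_, fun γ hγ => ?_, fun _ γ hγ => ?_⟩
  · exact CondMalliavin.exists_isCarreDuChamp hZ hX hindep hf hgm hF2 hgen.1 hFe.ne
      ((CondMalliavin.gradEnergy_le_one hZ hX hindep hg hvar).trans_lt ENNReal.one_lt_top).ne
  · exact CondMalliavin.wassersteinDist_gaussianReal_le hZ hX hindep hf hgm hgen hγ
  · have hbound := CondMalliavin.wassersteinDist_gaussianReal_le_evariance_add hZ hX hindep hf
      hcent hvar hg hγ
    refine ⟨fun H hH => ?_, hbound⟩
    have h0 : 0 ≤ -∫ ω, CondMalliavin.functional Z X f ω * H ω ∂μ :=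
      (CondMalliavin.hasSum_integral_grad_sq hZ hX hindep hf hH).nonneg
        fun a => integral_nonneg fun ω => sq_nonneg _
    rw [CondMalliavin.gradEnergy_eq_ofReal hZ hX hindep hf hH,
      ENNReal.ofReal_rpow_of_nonneg h0 (by norm_num), ← Real.sqrt_eq_rpow] at hbound
    exact hbound
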